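/- Consider discs in the Euclidean plane of three radii $0<s<r<1$ (small: $s$, medium: $r$, large: $1$). A \emph{packing} is a set of such discs with pairwise disjoint interiors, in which each of the three radii appears, and which is compact: every interstice, i.e. every connected component of the complement of the union of the closed discs, is a curvilinear triangle bounded by three pairwise tangent discs of the packing. The \emph{corona} of a disc of the packing is the set of the discs of the packing tangent to it; a \emph{coding} of it is the word of the radii of these discs, listed once each in an order such that each disc is tangent to the next one and the last one to the first. A corona is \emph{small} if the disc it surrounds is small; a packing contains the small corona $w$ if $w$ is a coding of the corona of one of its small discs. The pair $(r,s)$ is \emph{compatible} with the small corona $w=w_1\cdots w_n$ if $\sum_{i=1}^n \widehat{w_i\,s\,w_{i+1}}=2\pi$ (with $w_{n+1}=w_1$), where $\widehat{xyz}$ denotes the angle, in the triangle of the centres of three pairwise tangent discs of radii $x,y,z$, at the centre of the disc of radius $y$. \textbf{Proposition.} If $0<s<r<1$ are such that $(r,s)$ is compatible with both small coronas $1srrs$ and $1s1ss$, then no packing by discs of radii $1,r,s$ contains the small corona $1s1ss$. -/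

import Mathlib

/-- The Euclidean plane. -/
abbrev Plane : Type := EuclideanSpace ℝ (Fin 2)

/-- A disc of the plane, given by its centre and its (positive) radius. -/
@[ext]
structure Disc where
  center : Plane
  radius : ℝ
  radius_pos : 0 < radius

/-- The closed disc, as a set of points. -/
def Disc.carrier (D : Disc) : Set Plane := Metric.closedBall D.center D.radius

/-- Two discs are (externally) tangent. -/
def Disc.Tangent (D E : Disc) : Prop := dist D.center E.center = D.radius + E.radius

/-- The curvilinear triangle between three discs: the triangle of the centres, deprived of the
three closed discs. It is used for pairwise tangent discs; the sides of the triangle are then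
covered by the discs. -/
def curvilinearTriangle (D E F : Disc) : Set Plane :=
  convexHull ℝ {D.center, E.center, F.center} \ (D.carrier ∪ E.carrier ∪ F.carrier)

/-- A disc packing: a set of discs with pairwise disjoint interiors. -/
def IsDiscPacking (P : Set Disc) : Prop :=
  P.Pairwise fun D E => Disjoint (Metric.ball D.center D.radius) (Metric.ball E.center E.radius)

/-- The part of the plane not covered by the discs of `P`. -/
def uncovered (P : Set Disc) : Set Plane := (⋃ D ∈ P, D.carrier)ᶜ

/-- The interstices of `P`: the connected components of the uncovered part of the plane. -/
def interstices (P : Set Disc) : Set (Set Plane) :=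
  {I | ∃ p ∈ uncovered P, I = connectedComponentIn (uncovered P) p}

/-- A compact packing: a disc packing all of whose interstices are curvilinear triangles between
three pairwise tangent discs of the packing. -/
structure IsCompactPacking (P : Set Disc) : Prop where
  packing : IsDiscPacking P
  triangulated : ∀ I ∈ interstices P, ∃ D ∈ P, ∃ E ∈ P, ∃ F ∈ P,
    D.Tangent E ∧ E.Tangent F ∧ F.Tangent D ∧ I = curvilinearTriangle D E F

/-- A compact packing by discs of radii `1`, `r` and `s`, where each of these radii appears. -/
structure IsThreeSizePacking (r s : ℝ) (P : Set Disc) : Prop where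
  compact : IsCompactPacking P
  radii : ∀ D ∈ P, D.radius = 1 ∨ D.radius = r ∨ D.radius = s
  exists_large : ∃ D ∈ P, D.radius = 1
  exists_medium : ∃ D ∈ P, D.radius = r
  exists_small : ∃ D ∈ P, D.radius = s

/-- The corona of `D` in `P`: the discs of `P` that are tangent to `D`. -/
def corona (P : Set Disc) (D : Disc) : Set Disc := {E | E ∈ P ∧ E.Tangent D}

/-- The word `w` is a coding of the corona of `D` in `P`: the discs of the corona can be listed,
each once, so that each is tangent to the next and the last to the first, with `w` as the word of
their radii. -/
def IsCoronaCoding (P : Set Disc) (D : Disc) (w : List ℝ) : Prop :=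
  ∃ L : List Disc, L.Nodup ∧ (∀ E, E ∈ L ↔ E ∈ corona P D) ∧
    List.Forall₂ Disc.Tangent L (L.rotate 1) ∧ L.map Disc.radius = w

/-- `P` contains the corona coded by `w` around a disc of radius `y`. -/
def ContainsCorona (P : Set Disc) (y : ℝ) (w : List ℝ) : Prop :=
  ∃ D ∈ P, D.radius = y ∧ IsCoronaCoding P D w

/-- The angle at the centre of the disc of radius `y` in the triangle of the centres of three
pairwise tangent discs of radii `x`, `y`, `z`, by the law of cosines: the sides of this triangle
are `x + y`, `y + z` and `x + z`. -/
noncomputable def tangentAngle (x y z : ℝ) : ℝ :=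
  Real.arccos (((x + y) ^ 2 + (y + z) ^ 2 - (x + z) ^ 2) / (2 * (x + y) * (y + z)))

/-- The sum of the angles at the centre of a disc of radius `y` between cyclically consecutive
discs with radii the letters of `w`. -/
noncomputable def coronaAngleSum (y : ℝ) (w : List ℝ) : ℝ :=
  (List.zipWith (fun x z => tangentAngle x y z) w (w.rotate 1)).sum

/-- The radii are compatible with the corona coded by `w` around a disc of radius `y`: the angles
of this corona add up to a full turn. -/
def CoronaCompatible (y : ℝ) (w : List ℝ) : Prop := coronaAngleSum y w = 2 * Real.pi

/-! Write `xyz` for the angle at the disc `y`. Compatibility with `1s1ss` says that 4 · `1ss` + π/3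
= 2π, so `1ss` = 5π/12 and s ≈ 0.349. Compatibility with `1srrs` then gives 2 · `rss` + `rsr` =
7π/6, which confines r enough to bound the other angles.

The corona `1s1ss` is contagious. Around a small neighbour of a small disc S with this corona, S
appears between its two common neighbours with that disc. This uses 5π/6 or 3π/4 of the full turn.
Such a corona has five discs (`IsTurn.eq_five`), and the angle bounds leave one way to fill the gap,
which gives `1s1ss` again (`eq_small_of_angle_sum_one_one`,
`eq_small_large_of_angle_sum_one_small`). As no two large discs are adjacent in `1s1ss`, turning
around a large neighbour of S leads from S to a small neighbour of S, which has the same corona; so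
every disc touching that large disc has it too. The discs with this corona and their large
neighbours are therefore closed under tangency. The contact graph being connected
(`IsBoundedPacking.mem_of_tangent_closed`), they form the whole packing, leaving no room for a
medium disc.

Compactness speaks only of components of the complement, so the cyclic structure of coronas has to
be derived. Each oriented contact borders a triangular face (`IsBoundedPacking.exists_face`), no
disc touches the centre of a turn inside the angle of a face (`IsFace.not_tangentAt`), and hence
successive faces close up after exactly 2π (`IsTurn.exists_full_turn`). -/

/-! ### Planar geometry -/

/-- The unit vector with argument `θ`. -/
noncomputable def dir (θ : ℝ) : Plane := !₂[Real.cos θ, Real.sin θ]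

/-- The determinant of two vectors of the plane. -/
def planeDet (x y : Plane) : ℝ := x 0 * y 1 - x 1 * y 0

lemma norm_sq_plane (x : Plane) : ‖x‖ ^ 2 = x 0 ^ 2 + x 1 ^ 2 := by
  rw [EuclideanSpace.norm_sq_eq, Fin.sum_univ_two]; simp

lemma dist_sq_plane (x y : Plane) : dist x y ^ 2 = (x 0 - y 0) ^ 2 + (x 1 - y 1) ^ 2 := by
  rw [dist_eq_norm, norm_sq_plane]; simp

lemma plane_ext {x y : Plane} (h0 : x 0 = y 0) (h1 : x 1 = y 1) : x = y := by
  ext i; fin_cases i <;> assumption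

@[simp] lemma dir_zero (θ : ℝ) : dir θ 0 = Real.cos θ := rfl
@[simp] lemma dir_one (θ : ℝ) : dir θ 1 = Real.sin θ := rfl

lemma norm_dir (θ : ℝ) : ‖dir θ‖ = 1 := by
  have h := norm_sq_plane (dir θ)
  rw [dir_zero, dir_one, Real.cos_sq_add_sin_sq] at h
  nlinarith [norm_nonneg (dir θ)]

lemma dir_add_two_pi (θ : ℝ) : dir (θ + 2 * Real.pi) = dir θ :=
  plane_ext (by simp) (by simp)

lemma dir_add_int_mul (θ : ℝ) (k : ℤ) : dir (θ + k * (2 * Real.pi)) = dir θ :=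
  plane_ext (by simp [Real.cos_add_int_mul_two_pi]) (by simp [Real.sin_add_int_mul_two_pi])

lemma exists_dir {x : Plane} (hx : ‖x‖ = 1) : ∃ θ, x = dir θ := by
  have h := norm_sq_plane x
  rw [hx] at h
  have hz : ‖(⟨x 0, x 1⟩ : ℂ)‖ = 1 := by
    rw [Complex.norm_eq_sqrt_sq_add_sq, ← h]; simp
  have hz0 : (⟨x 0, x 1⟩ : ℂ) ≠ 0 := by
    intro h0; rw [h0] at hz; simp at hz
  refine ⟨Complex.arg ⟨x 0, x 1⟩, plane_ext ?_ ?_⟩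
  · rw [dir_zero, Complex.cos_arg hz0, hz]; simp
  · rw [dir_one, Complex.sin_arg, hz]; simp

lemma dir_inj_of_lt {a b : ℝ} (hab : a ≤ b) (hlt : b < a + 2 * Real.pi) (h : dir a = dir b) :
    a = b := by
  have h0 : Real.cos a = Real.cos b := congrArg (fun x : Plane => x 0) h
  have h1 : Real.sin a = Real.sin b := congrArg (fun x : Plane => x 1) h
  have hc : Real.cos (b - a) = 1 := by
    rw [Real.cos_sub, h0, h1, ← sq, ← sq, Real.cos_sq_add_sin_sq]
  have := (Real.cos_eq_one_iff_of_lt_of_lt (x := b - a)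
    (by linarith [Real.pi_pos]) (by linarith)).1 hc
  linarith

lemma mem_convexHull_triple {A B C x : Plane} :
    x ∈ convexHull ℝ {A, B, C} ↔
      ∃ b c : ℝ, 0 ≤ b ∧ 0 ≤ c ∧ b + c ≤ 1 ∧ x = A + b • (B - A) + c • (C - A) := by
  rw [convexHull_insert (by simp), convexHull_pair]
  constructor
  · intro h
    rw [mem_convexJoin] at h
    obtain ⟨a, ha, y, hy, hx⟩ := h
    rw [Set.mem_singleton_iff] at ha
    subst ha
    rw [segment_eq_image'] at hy hx
    obtain ⟨u, ⟨hu0, hu1⟩, rfl⟩ := hy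
    obtain ⟨v, ⟨hv0, hv1⟩, rfl⟩ := hx
    refine ⟨v * (1 - u), v * u, mul_nonneg hv0 (by linarith), mul_nonneg hv0 hu0,
      by linarith, ?_⟩
    module
  · rintro ⟨b, c, hb, hc, hbc, rfl⟩
    rw [mem_convexJoin]
    refine ⟨A, rfl, ?_⟩
    rcases (add_nonneg hb hc).eq_or_lt with h0 | h0
    · have hb0 : b = 0 := by linarith
      have hc0 : c = 0 := by linarith
      exact ⟨B, left_mem_segment ℝ B C, by subst hb0 hc0; simpa using left_mem_segment ℝ A B⟩
    · refine ⟨B + (c / (b + c)) • (C - B), ?_, ?_⟩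
      · rw [segment_eq_image']
        exact ⟨c / (b + c), ⟨by positivity, (div_le_one h0).2 (by linarith)⟩, rfl⟩
      · rw [segment_eq_image']
        refine ⟨b + c, ⟨h0.le, hbc⟩, ?_⟩
        have : c = (b + c) * (c / (b + c)) := by field_simp
        have h2 : (b + c) • (B + (c / (b + c)) • (C - B) - A) =
            (b + c) • (B - A) + ((b + c) * (c / (b + c))) • (C - B) := by module
        simp only [h2, ← this]
        module

lemma convexHull_triple_subset_closedBall {A B C : Plane} {R : ℝ} (hR : 0 ≤ R)
    (hB : dist B A ≤ R) (hC : dist C A ≤ R) :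
    convexHull ℝ {A, B, C} ⊆ Metric.closedBall A R := by
  refine convexHull_min ?_ (convex_closedBall A R)
  rintro x (rfl | rfl | rfl)
  · simpa using hR
  · exact hB
  · exact hC

/-! ### Tangent discs -/

lemma Disc.Tangent.symm {D E : Disc} (h : D.Tangent E) : E.Tangent D := by
  unfold Disc.Tangent at *; rw [dist_comm, h, add_comm]

lemma Disc.Tangent.ne {D E : Disc} (h : D.Tangent E) : D ≠ E := by
  rintro rfl
  unfold Disc.Tangent at h
  have := D.radius_pos
  rw [dist_self] at h; linarith

/-- The distances from a point of the segment to the two centres add up to the sum of the radii, so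
one of them is at most its radius. -/
lemma segment_subset_of_tangent {D E : Disc} (h : D.Tangent E) {x : Plane} {t : ℝ}
    (ht0 : 0 ≤ t) (ht1 : t ≤ 1) (hx : x = D.center + t • (E.center - D.center)) :
    x ∈ D.carrier ∨ x ∈ E.carrier := by
  have hD : dist x D.center = t * (D.radius + E.radius) := by
    rw [hx, dist_eq_norm, add_sub_cancel_left, norm_smul, Real.norm_of_nonneg ht0, ← dist_eq_norm,
      dist_comm, h]
  have hE : dist x E.center = (1 - t) * (D.radius + E.radius) := by
    rw [hx, dist_eq_norm, show D.center + t • (E.center - D.center) - E.center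
      = (1 - t) • (D.center - E.center) by module, norm_smul,
      Real.norm_of_nonneg (by linarith), ← dist_eq_norm, h]
  by_contra! hc
  simp only [Disc.carrier, Metric.mem_closedBall, not_le] at hc
  linarith [hc.1, hc.2]

lemma curvilinearTriangle_rotate (D E F : Disc) :
    curvilinearTriangle E F D = curvilinearTriangle D E F := by
  unfold curvilinearTriangle
  congr 1
  · congr 1; ext x; simp only [Set.mem_insert_iff, Set.mem_singleton_iff]; tauto
  · ext x; simp only [Set.mem_union]; tauto

lemma curvilinearTriangle_swap (D E F : Disc) :
    curvilinearTriangle D F E = curvilinearTriangle D E F := by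
  unfold curvilinearTriangle
  congr 1
  · congr 1; ext x; simp only [Set.mem_insert_iff, Set.mem_singleton_iff]; tauto
  · ext x; simp only [Set.mem_union]; tauto

/-- `E` is tangent to `D`, with its centre in the direction `θ`. -/
def Disc.TangentAt (D E : Disc) (θ : ℝ) : Prop :=
  E.center = D.center + (D.radius + E.radius) • dir θ

lemma Disc.TangentAt.tangent {D E : Disc} {θ : ℝ} (h : D.TangentAt E θ) : D.Tangent E := by
  unfold Disc.Tangent
  rw [h, dist_self_add_right, norm_smul, norm_dir, mul_one, Real.norm_of_nonneg]
  have := D.radius_pos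
  have := E.radius_pos
  positivity

lemma Disc.Tangent.exists_tangentAt {D E : Disc} (h : D.Tangent E) : ∃ θ, D.TangentAt E θ := by
  have hD := D.radius_pos
  have hE := E.radius_pos
  have hpos : 0 < D.radius + E.radius := by positivity
  obtain ⟨θ, hθ⟩ := exists_dir (x := (D.radius + E.radius)⁻¹ • (E.center - D.center)) (by
    rw [norm_smul, norm_inv, Real.norm_of_nonneg hpos.le, ← dist_eq_norm, dist_comm, h]
    field_simp)
  refine ⟨θ, ?_⟩
  unfold Disc.TangentAt
  rw [← hθ, smul_smul, mul_inv_cancel₀ hpos.ne', one_smul]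
  abel

/-! ### Disc packings -/

lemma IsDiscPacking.add_le_dist {P : Set Disc} (hP : IsDiscPacking P) {D E : Disc} (hD : D ∈ P)
    (hE : E ∈ P) (hne : D ≠ E) : D.radius + E.radius ≤ dist D.center E.center :=
  (disjoint_ball_ball_iff D.radius_pos E.radius_pos).1 (hP hD hE hne)

lemma IsDiscPacking.eq_of_mem {P : Set Disc} (hP : IsDiscPacking P) {D E : Disc} (hD : D ∈ P)
    (hE : E ∈ P) {x : Plane} (hxD : x ∈ D.carrier) (hxE : dist x E.center < E.radius) :
    D = E := by
  by_contra hne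
  have h := hP.add_le_dist hD hE hne
  have h1 := dist_triangle_left D.center E.center x
  have h2 : dist x D.center ≤ D.radius := hxD
  linarith

lemma IsDiscPacking.tangent_of_mem {P : Set Disc} (hP : IsDiscPacking P) {D E : Disc}
    (hD : D ∈ P) (hE : E ∈ P) {x : Plane} (hxD : x ∈ D.carrier) (hxE : x ∈ E.carrier)
    (hne : D ≠ E) : D.Tangent E := by
  have h := hP.add_le_dist hD hE hne
  have h1 := dist_triangle_left D.center E.center x
  have h2 : dist x D.center ≤ D.radius := hxD
  have h3 : dist x E.center ≤ E.radius := hxE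
  unfold Disc.Tangent
  linarith

lemma IsDiscPacking.eq_of_tangentAt {P : Set Disc} (hP : IsDiscPacking P) {D E F : Disc}
    (hE : E ∈ P) (hF : F ∈ P) {θ : ℝ} (hDE : D.TangentAt E θ)
    (hDF : D.TangentAt F θ) : E = F := by
  by_contra hne
  have h := hP.add_le_dist hE hF hne
  rw [hDE, hDF, dist_add_left, dist_eq_norm, ← sub_smul, norm_smul, norm_dir, mul_one,
    Real.norm_eq_abs] at h
  have := D.radius_pos
  have := E.radius_pos
  have := F.radius_pos
  rcases abs_cases (D.radius + E.radius - (D.radius + F.radius)) with h' | h' <;> linarith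

/-- The contact point of two tangent discs of a packing belongs to no other disc. -/
lemma IsDiscPacking.eq_or_eq_of_mem_contact {P : Set Disc} (hP : IsDiscPacking P) {D E G : Disc}
    (hD : D ∈ P) (hE : E ∈ P) (hG : G ∈ P) {θ : ℝ} (h : D.TangentAt E θ)
    (hx : D.center + D.radius • dir θ ∈ G.carrier) : G = D ∨ G = E := by
  by_contra! hne
  have h1 := hP.add_le_dist hG hD hne.1
  have h2 := hP.add_le_dist hG hE hne.2
  have h3 : dist (D.center + D.radius • dir θ) G.center ≤ G.radius := hx
  have rD := D.radius_pos
  have rE := E.radius_pos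
  have rG := G.radius_pos
  have h1' := pow_le_pow_left₀ (by positivity) h1 2
  have h2' := pow_le_pow_left₀ (by positivity) h2 2
  have h3' := pow_le_pow_left₀ dist_nonneg h3 2
  rw [dist_sq_plane] at h1' h2' h3'
  rw [h] at h2'
  simp only [PiLp.add_apply, PiLp.smul_apply, smul_eq_mul, dir_zero, dir_one] at h1' h2' h3'
  have hcs := Real.cos_sq_add_sin_sq θ
  generalize Real.cos θ = c at *
  generalize Real.sin θ = s at *
  generalize hgx : D.center 0 + D.radius * c - G.center 0 = gx at *
  generalize hgy : D.center 1 + D.radius * s - G.center 1 = gy at *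
  have e0 : G.center 0 = D.center 0 + D.radius * c - gx := by linarith
  have e1 : G.center 1 = D.center 1 + D.radius * s - gy := by linarith
  rw [e0, e1] at h1' h2'
  ring_nf at h1' h2' h3'
  -- With g the vector from the centre of G to the contact point, disjointness from D and from E
  -- bounds the component of g along the axis by -G.radius from above and by G.radius from below.
  have k1 : D.radius * G.radius ≤ -D.radius * (gx * c + gy * s) := by
    have : D.radius ^ 2 * c ^ 2 + D.radius ^ 2 * s ^ 2 = D.radius ^ 2 := by
      rw [← mul_add, hcs, mul_one]
    nlinarith
  have k2 : E.radius * G.radius ≤ E.radius * (gx * c + gy * s) := by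
    have : E.radius ^ 2 * c ^ 2 + E.radius ^ 2 * s ^ 2 = E.radius ^ 2 := by
      rw [← mul_add, hcs, mul_one]
    nlinarith
  have k1' : G.radius ≤ -(gx * c + gy * s) := by nlinarith
  have k2' : G.radius ≤ gx * c + gy * s := le_of_mul_le_mul_left k2 rE
  linarith

/-! ### Local finiteness -/

/-- The radii of the discs are bounded below by `s > 0` and above by `1`. -/
structure IsBoundedPacking (s : ℝ) (P : Set Disc) : Prop where
  packing : IsDiscPacking P
  pos : 0 < s
  le_radius : ∀ D ∈ P, s ≤ D.radius
  radius_le : ∀ D ∈ P, D.radius ≤ 1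

/-- Distinct centres are at least 2s apart, so each of finitely many balls of radius s covering the
closed ball contains at most one. -/
lemma IsBoundedPacking.finite_near {s : ℝ} {P : Set Disc} (hP : IsBoundedPacking s P) (p : Plane)
    (R : ℝ) : {D ∈ P | dist D.center p ≤ R}.Finite := by
  obtain ⟨t, -, htf, ht⟩ := (isCompact_closedBall p R).finite_cover_balls hP.pos
  refine (htf.biUnion (t := fun x => {D ∈ P | dist D.center x < s}) fun x _ => ?_).subset ?_
  · refine Set.Subsingleton.finite ?_
    rintro D ⟨hD, hDx⟩ E ⟨hE, hEx⟩
    by_contra hne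
    have h1 := hP.packing.add_le_dist hD hE hne
    have h2 := dist_triangle_right D.center E.center x
    linarith [hP.le_radius D hD, hP.le_radius E hE]
  · rintro D ⟨hD, hDp⟩
    have := ht (Metric.mem_closedBall.2 hDp)
    simp only [Set.mem_iUnion, Metric.mem_ball] at this ⊢
    obtain ⟨x, hx, hDx⟩ := this
    exact ⟨x, hx, hD, hDx⟩

/-- Near a point, a bounded packing has no other discs than those containing the point. -/
lemma IsBoundedPacking.exists_nhds {s : ℝ} {P : Set Disc} (hP : IsBoundedPacking s P) (p : Plane) :
    ∃ ε > 0, ∀ D ∈ P, ∀ x ∈ Metric.ball p ε, x ∈ D.carrier → p ∈ D.carrier := by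
  have hfin := (hP.finite_near p 2).subset (fun D (h : D ∈ {D ∈ P | dist D.center p ≤ 2 ∧
    p ∉ D.carrier}) => (⟨h.1, h.2.1⟩ : D ∈ {D ∈ P | dist D.center p ≤ 2}))
  have hev : ∀ᶠ x in nhds p, ∀ D ∈ {D ∈ P | dist D.center p ≤ 2 ∧ p ∉ D.carrier},
      x ∉ D.carrier := by
    rw [Filter.eventually_all_finite hfin]
    rintro D ⟨-, -, hD⟩
    exact Metric.isClosed_closedBall.isOpen_compl.mem_nhds hD
  obtain ⟨ε, hε, h⟩ := Metric.eventually_nhds_iff_ball.1 hev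
  refine ⟨min ε 1, by positivity, fun D hD x hx hxD => ?_⟩
  by_contra hp
  have hx1 : dist x p < 1 := lt_of_lt_of_le hx (min_le_right _ _)
  have hx2 : dist x D.center ≤ D.radius := hxD
  refine h x (Metric.ball_subset_ball (min_le_left _ _) hx) D ⟨hD, ?_, hp⟩ hxD
  have := dist_triangle_left D.center p x
  linarith [hP.radius_le D hD]

lemma mem_uncovered {P : Set Disc} {x : Plane} : x ∈ uncovered P ↔ ∀ D ∈ P, x ∉ D.carrier := by
  simp [uncovered]

/-! ### Faces of the contact graph -/

/-- Three pairwise tangent discs of `P`, in counterclockwise order, whose curvilinear triangle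
meets no disc of `P`. -/
structure IsFace (P : Set Disc) (D E F : Disc) : Prop where
  mem₁ : D ∈ P
  mem₂ : E ∈ P
  mem₃ : F ∈ P
  tangent₁₂ : D.Tangent E
  tangent₂₃ : E.Tangent F
  tangent₃₁ : F.Tangent D
  det_pos : 0 < planeDet (E.center - D.center) (F.center - D.center)
  subset : curvilinearTriangle D E F ⊆ uncovered P

lemma IsFace.rotate {P : Set Disc} {D E F : Disc} (h : IsFace P D E F) : IsFace P E F D where
  mem₁ := h.mem₂
  mem₂ := h.mem₃
  mem₃ := h.mem₁
  tangent₁₂ := h.tangent₂₃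
  tangent₂₃ := h.tangent₃₁
  tangent₃₁ := h.tangent₁₂
  det_pos := by
    have := h.det_pos
    simp only [planeDet, PiLp.sub_apply] at this ⊢
    nlinarith
  subset := by rw [curvilinearTriangle_rotate]; exact h.subset

/-- If D were a further disc, moving from its contact point with A slightly into D would stay in the
triangle of the centres and reach a point of the curvilinear triangle covered by D. -/
lemma IsDiscPacking.eq_or_eq_of_contact_mem {P : Set Disc} (hP : IsDiscPacking P) {A B C D : Disc}
    (hA : A ∈ P) (hB : B ∈ P) (hC : C ∈ P) (hD : D ∈ P) (hAB : A.Tangent B) (hBC : B.Tangent C)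
    (hCA : C.Tangent A) (hsub : curvilinearTriangle A B C ⊆ uncovered P) {θ : ℝ}
    (hAD : A.TangentAt D θ)
    (hp : A.center + A.radius • dir θ ∈ convexHull ℝ {A.center, B.center, C.center}) :
    D = B ∨ D = C := by
  by_contra! hne
  have rA := A.radius_pos
  have rD := D.radius_pos
  have hDA : D ≠ A := hAD.tangent.symm.ne
  obtain ⟨b, c, hb, hc, hbc, hpe⟩ := mem_convexHull_triple.1 hp
  -- Otherwise the contact point lies on the side opposite to A, which is covered by B and C.
  have hlt : b + c < 1 := by
    refine lt_of_le_of_ne hbc fun h1 => ?_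
    have hb1 : b = 1 - c := by linarith
    rcases segment_subset_of_tangent hBC hc (by linarith)
      (x := A.center + A.radius • dir θ) (by rw [hpe, hb1]; module) with h | h
    · rcases hP.eq_or_eq_of_mem_contact hA hD hB hAD h with h | h
      · exact hAB.ne h.symm
      · exact hne.1 h.symm
    · rcases hP.eq_or_eq_of_mem_contact hA hD hC hAD h with h | h
      · exact hCA.ne h
      · exact hne.2 h.symm
  -- With u = b + c, the second bound keeps the moved point in the triangle, because (1 + (1 - u)) u
  -- ≤ 1.
  obtain ⟨t, ht0, htD, htA⟩ : ∃ t > 0, t ≤ D.radius ∧ t ≤ A.radius * (1 - (b + c)) :=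
    ⟨min D.radius (A.radius * (1 - (b + c))), lt_min rD (mul_pos rA (by linarith)),
      min_le_left _ _, min_le_right _ _⟩
  have hv : A.radius • dir θ = b • (B.center - A.center) + c • (C.center - A.center) := by
    rw [add_assoc] at hpe
    exact add_left_cancel hpe
  have hd : A.center + (A.radius + t) • dir θ ∈
      convexHull ℝ {A.center, B.center, C.center} := by
    rw [mem_convexHull_triple]
    refine ⟨(1 + t / A.radius) * b, (1 + t / A.radius) * c, by positivity, by positivity, ?_, ?_⟩
    · have h1 : t / A.radius ≤ 1 - (b + c) := by
        rw [div_le_iff₀ rA]; linarith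
      nlinarith [mul_le_mul_of_nonneg_right h1 (add_nonneg hb hc), sq_nonneg (1 - (b + c))]
    · have : (A.radius + t) • dir θ = (1 + t / A.radius) • (A.radius • dir θ) := by
        rw [smul_smul]; congr 1; field_simp
      rw [this, hv]
      module
  have hdD : dist (A.center + (A.radius + t) • dir θ) D.center < D.radius := by
    rw [hAD, dist_add_left, dist_eq_norm, ← sub_smul, norm_smul, norm_dir, mul_one,
      Real.norm_eq_abs, abs_lt]
    constructor <;> linarith
  have hmem : A.center + (A.radius + t) • dir θ ∈ curvilinearTriangle A B C := by
    refine ⟨hd, ?_⟩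
    rintro ((h | h) | h)
    · exact hDA (hP.eq_of_mem hA hD h hdD).symm
    · exact hne.1 (hP.eq_of_mem hB hD h hdD).symm
    · exact hne.2 (hP.eq_of_mem hC hD h hdD).symm
  exact mem_uncovered.1 (hsub hmem) D hD hdD.le

lemma mem_interstice_subset {P : Set Disc} {I : Set Plane} (hI : I ∈ interstices P) :
    I ⊆ uncovered P := by
  obtain ⟨p, -, rfl⟩ := hI
  exact connectedComponentIn_subset _ _

lemma Disc.TangentAt.contact_symm {D E : Disc} {θ : ℝ} (h : D.TangentAt E θ) :
    E.TangentAt D (θ + Real.pi) ∧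
      E.center + E.radius • dir (θ + Real.pi) = D.center + D.radius • dir θ := by
  have hd : dir (θ + Real.pi) = -dir θ := plane_ext (by simp) (by simp)
  unfold Disc.TangentAt at *
  rw [hd, h]
  constructor <;> module

/-- Near the contact point, the left half of the common tangent line is uncovered, so it lies in one
interstice. The closed triangle of that interstice contains the contact point, which forces D and E
to be two of its three discs. -/
lemma IsBoundedPacking.exists_face {s : ℝ} {P : Set Disc} (hP : IsBoundedPacking s P)
    (hc : IsCompactPacking P) {D E : Disc} (hD : D ∈ P) (hE : E ∈ P) (hDE : D.Tangent E) :
    ∃ F, IsFace P D E F := by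
  obtain ⟨θ, hθ⟩ := hDE.exists_tangentAt
  have rD := D.radius_pos
  have rE := E.radius_pos
  set p : Plane := D.center + D.radius • dir θ with hp
  set n : Plane := dir (θ + Real.pi / 2) with hn
  have n0 : n 0 = -Real.sin θ := by simp [hn, Real.cos_add_pi_div_two]
  have n1 : n 1 = Real.cos θ := by simp [hn, Real.sin_add_pi_div_two]
  have hcs := Real.cos_sq_add_sin_sq θ
  obtain ⟨ε, hε, hnear⟩ := hP.exists_nhds p
  -- the points of the common tangent line close to the contact point are uncovered
  have hq : ∀ t, 0 < t → t < ε → p + t • n ∈ uncovered P := by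
    intro t ht0 htε
    rw [mem_uncovered]
    intro G hG hGx
    have hball : p + t • n ∈ Metric.ball p ε := by
      rw [Metric.mem_ball, dist_self_add_left, norm_smul, hn, norm_dir, mul_one,
        Real.norm_of_nonneg ht0.le]
      exact htε
    rcases hP.packing.eq_or_eq_of_mem_contact hD hE hG hθ (hnear G hG _ hball hGx) with rfl | rfl
    · have h1 := pow_le_pow_left₀ dist_nonneg (Metric.mem_closedBall.1 hGx) 2
      rw [dist_sq_plane] at h1
      simp only [hp, PiLp.add_apply, PiLp.smul_apply, smul_eq_mul, n0, n1, dir_zero,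
        dir_one] at h1
      have : G.radius ^ 2 + t ^ 2 ≤ G.radius ^ 2 := by
        calc G.radius ^ 2 + t ^ 2
            = (G.radius ^ 2 + t ^ 2) * (Real.cos θ ^ 2 + Real.sin θ ^ 2) := by rw [hcs, mul_one]
          _ ≤ G.radius ^ 2 := by refine le_trans (le_of_eq ?_) h1; ring
      nlinarith
    · have h1 := pow_le_pow_left₀ dist_nonneg (Metric.mem_closedBall.1 hGx) 2
      rw [dist_sq_plane, hθ] at h1
      simp only [hp, PiLp.add_apply, PiLp.smul_apply, smul_eq_mul, n0, n1, dir_zero,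
        dir_one] at h1
      have : G.radius ^ 2 + t ^ 2 ≤ G.radius ^ 2 := by
        calc G.radius ^ 2 + t ^ 2
            = (G.radius ^ 2 + t ^ 2) * (Real.cos θ ^ 2 + Real.sin θ ^ 2) := by rw [hcs, mul_one]
          _ ≤ G.radius ^ 2 := by refine le_trans (le_of_eq ?_) h1; ring
      nlinarith
  have hcont : Continuous fun t : ℝ => p + t • n := by fun_prop
  have himg : IsPreconnected ((fun t : ℝ => p + t • n) '' Set.Ioo 0 ε) :=
    isPreconnected_Ioo.image _ hcont.continuousOn
  have hI : connectedComponentIn (uncovered P) (p + (ε / 2) • n) ∈ interstices P :=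
    ⟨_, hq _ (by linarith) (by linarith), rfl⟩
  have hsub : (fun t : ℝ => p + t • n) '' Set.Ioo 0 ε ⊆
      connectedComponentIn (uncovered P) (p + (ε / 2) • n) :=
    himg.subset_connectedComponentIn ⟨ε / 2, ⟨by linarith, by linarith⟩, rfl⟩ (by
      rintro _ ⟨t, ⟨h0, h1⟩, rfl⟩; exact hq t h0 h1)
  obtain ⟨A, hA, B, hB, C, hC, hAB, hBC, hCA, hIeq⟩ := hc.triangulated _ hI
  have hun := mem_interstice_subset hI
  rw [hIeq] at hsub hun
  have hhull : ∀ t ∈ Set.Ioo 0 ε, p + t • n ∈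
      convexHull ℝ {A.center, B.center, C.center} := fun t ht => (hsub ⟨t, ht, rfl⟩).1
  have hpcl : p ∈ convexHull ℝ {A.center, B.center, C.center} := by
    have hcl : IsClosed (convexHull ℝ {A.center, B.center, C.center}) :=
      Set.Finite.isClosed_convexHull ℝ (by simp)
    have htend : Filter.Tendsto (fun t : ℝ => p + t • n) (nhdsWithin 0 (Set.Ioi 0)) (nhds p) := by
      have := (hcont.tendsto 0).mono_left (nhdsWithin_le_nhds (s := Set.Ioi (0 : ℝ)))
      simpa using this
    exact hcl.mem_of_tendsto htend
      (Filter.eventually_of_mem (Ioo_mem_nhdsGT hε) hhull)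
  have hpD : p ∈ D.carrier := by
    rw [Disc.carrier, Metric.mem_closedBall, hp, dist_self_add_left, norm_smul, norm_dir, mul_one,
      Real.norm_of_nonneg rD.le]
  -- the final step, once the roles of the three discs are known
  have key : ∀ F ∈ P, E.Tangent F → F.Tangent D →
      curvilinearTriangle D E F = curvilinearTriangle A B C → IsFace P D E F := by
    intro F hF hEF hFD heq
    refine ⟨hD, hE, hF, hDE, hEF, hFD, ?_, heq ▸ hun⟩
    have hm : p + (ε / 2) • n ∈ curvilinearTriangle D E F := by
      rw [heq]; exact hsub ⟨ε / 2, ⟨by linarith, by linarith⟩, rfl⟩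
    obtain ⟨b, c, hb, hc', hbc, he⟩ := mem_convexHull_triple.1 hm.1
    have e0 := congrArg (fun x : Plane => x 0) he
    have e1 := congrArg (fun x : Plane => x 1) he
    simp only [hp, PiLp.add_apply, PiLp.smul_apply, PiLp.sub_apply, smul_eq_mul, n0, n1, dir_zero,
        dir_one] at e0 e1
    -- Both sides compute the determinant of the direction from D to E with the chosen point, which
    -- is to the left; c is the barycentric coordinate of F.
    have hdet : (D.radius + E.radius) * (ε / 2) =
        c * planeDet (E.center - D.center) (F.center - D.center) := by
      have hE0 : E.center 0 - D.center 0 = (D.radius + E.radius) * Real.cos θ := by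
        rw [hθ]; simp
      have hE1 : E.center 1 - D.center 1 = (D.radius + E.radius) * Real.sin θ := by
        rw [hθ]; simp
      simp only [planeDet, PiLp.sub_apply]
      rw [hE0] at e0 ⊢
      rw [hE1] at e1 ⊢
      linear_combination (-(D.radius + E.radius) * (ε / 2)) * hcs +
        (D.radius + E.radius) * Real.cos θ * e1 - (D.radius + E.radius) * Real.sin θ * e0
    have hpos : 0 < c * planeDet (E.center - D.center) (F.center - D.center) := by
      rw [← hdet]; positivity
    exact pos_of_mul_pos_right hpos hc'
  have hpABC : (p ∈ A.carrier ∨ p ∈ B.carrier) ∨ p ∈ C.carrier := by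
    by_contra hcon
    exact mem_uncovered.1 (hun ⟨hpcl, hcon⟩) D hD hpD
  -- if one of the three discs contains the contact point, all is known
  have step : ∀ A' ∈ P, ∀ B' ∈ P, ∀ C' ∈ P, A'.Tangent B' → B'.Tangent C' → C'.Tangent A' →
      curvilinearTriangle A' B' C' = curvilinearTriangle A B C →
      p ∈ convexHull ℝ {A'.center, B'.center, C'.center} →
      p ∈ A'.carrier → ∃ F, IsFace P D E F := by
    intro A' hA' B' hB' C' hC' hAB' hBC' hCA' heq hhull' hpA'
    have hsub' : curvilinearTriangle A' B' C' ⊆ uncovered P := by rw [heq]; exact hun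
    rcases hP.packing.eq_or_eq_of_mem_contact hD hE hA' hθ hpA' with rfl | rfl
    · rcases hP.packing.eq_or_eq_of_contact_mem hD hB' hC' hE hAB' hBC' hCA' hsub' hθ hhull' with
        rfl | rfl
      · exact ⟨C', key C' hC' hBC' hCA' heq⟩
      · refine ⟨B', key B' hB' hBC'.symm hAB'.symm ?_⟩
        rw [curvilinearTriangle_swap, heq]
    · obtain ⟨hθ', hpe⟩ := hθ.contact_symm
      rcases hP.packing.eq_or_eq_of_contact_mem hE hB' hC' hD hAB' hBC' hCA' hsub' hθ'
        (by rw [hpe]; exact hhull') with rfl | rfl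
      · refine ⟨C', key C' hC' hCA'.symm hBC'.symm ?_⟩
        exact ((curvilinearTriangle_swap _ _ _).symm.trans
          (curvilinearTriangle_rotate _ _ _)).trans heq
      · refine ⟨B', key B' hB' hAB' hBC' ?_⟩
        rw [← heq, ← curvilinearTriangle_rotate]
  have hrot : ∀ x y z : Plane, ({y, z, x} : Set Plane) = {x, y, z} := by
    intro x y z; ext w; simp only [Set.mem_insert_iff, Set.mem_singleton_iff]; tauto
  rcases hpABC with (h | h) | h
  · exact step A hA B hB C hC hAB hBC hCA rfl hpcl h
  · exact step B hB C hC A hA hBC hCA hAB (curvilinearTriangle_rotate _ _ _)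
      (by rw [hrot]; exact hpcl) h
  · exact step C hC A hA B hB hCA hAB hBC
      (by rw [curvilinearTriangle_rotate, curvilinearTriangle_rotate])
      (by rw [hrot, hrot]; exact hpcl) h

/-! ### Angles of the faces -/

/-- This is the half-angle form: the squared sine of half the angle is a product of one factor for x
and one for z, so monotonicity in the outer radii becomes visible. -/
lemma tangentAngle_eq {x y z : ℝ} (hx : 0 < x) (hy : 0 < y) (hz : 0 < z) :
    tangentAngle x y z = Real.arccos (1 - 2 * (x / (x + y)) * (z / (z + y))) := by
  unfold tangentAngle
  congr 1
  field_simp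
  ring

lemma div_add_mem_Ioo {x y : ℝ} (hx : 0 < x) (hy : 0 < y) : x / (x + y) ∈ Set.Ioo (0 : ℝ) 1 :=
  ⟨by positivity, (div_lt_one (by positivity)).2 (by linarith)⟩

lemma cos_tangentAngle {x y z : ℝ} (hx : 0 < x) (hy : 0 < y) (hz : 0 < z) :
    Real.cos (tangentAngle x y z) = 1 - 2 * (x / (x + y)) * (z / (z + y)) := by
  obtain ⟨h1, h2⟩ := div_add_mem_Ioo hx hy
  obtain ⟨h3, h4⟩ := div_add_mem_Ioo hz hy
  rw [tangentAngle_eq hx hy hz, Real.cos_arccos] <;> nlinarith [mul_pos h1 h3]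

lemma tangentAngle_pos {x y z : ℝ} (hx : 0 < x) (hy : 0 < y) (hz : 0 < z) :
    0 < tangentAngle x y z := by
  obtain ⟨h1, h2⟩ := div_add_mem_Ioo hx hy
  obtain ⟨h3, h4⟩ := div_add_mem_Ioo hz hy
  rw [tangentAngle_eq hx hy hz, Real.arccos_pos]
  nlinarith [mul_pos h1 h3]

lemma tangentAngle_lt_pi {x y z : ℝ} (hx : 0 < x) (hy : 0 < y) (hz : 0 < z) :
    tangentAngle x y z < Real.pi := by
  obtain ⟨h1, h2⟩ := div_add_mem_Ioo hx hy
  obtain ⟨h3, h4⟩ := div_add_mem_Ioo hz hy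
  refine lt_of_le_of_ne (Real.arccos_le_pi _) fun h => ?_
  have := cos_tangentAngle hx hy hz
  rw [h, Real.cos_pi] at this
  nlinarith [mul_pos h1 h3]

lemma tangentAngle_comm (x y z : ℝ) : tangentAngle x y z = tangentAngle z y x := by
  unfold tangentAngle
  congr 1
  rw [show (z + y) ^ 2 + (y + x) ^ 2 - (z + x) ^ 2 = (x + y) ^ 2 + (y + z) ^ 2 - (x + z) ^ 2 by
    ring, show 2 * (z + y) * (y + x) = 2 * (x + y) * (y + z) by ring]

lemma tangentAngle_lt_tangentAngle {x x' y z : ℝ} (hx : 0 < x) (hy : 0 < y) (hz : 0 < z)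
    (h : x < x') : tangentAngle x y z < tangentAngle x' y z := by
  have hx' : 0 < x' := hx.trans h
  obtain ⟨h1, h2⟩ := div_add_mem_Ioo hx hy
  obtain ⟨h3, h4⟩ := div_add_mem_Ioo hz hy
  obtain ⟨h5, h6⟩ := div_add_mem_Ioo hx' hy
  have hlt : x / (x + y) < x' / (x' + y) := by
    rw [div_lt_div_iff₀ (by positivity) (by positivity)]; nlinarith
  rw [tangentAngle_eq hx hy hz, tangentAngle_eq hx' hy hz]
  apply Real.strictAntiOn_arccos
  · constructor <;> nlinarith [mul_pos h5 h3]
  · constructor <;> nlinarith [mul_pos h1 h3]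
  · nlinarith

lemma tangentAngle_mono {x x' y z z' : ℝ} (hx : 0 < x) (hy : 0 < y) (hz : 0 < z)
    (h : x ≤ x') (h' : z ≤ z') : tangentAngle x y z ≤ tangentAngle x' y z' := by
  have key : ∀ {x x' z : ℝ}, 0 < x → 0 < z → x ≤ x' →
      tangentAngle x y z ≤ tangentAngle x' y z := fun hx hz h => by
    rcases h.eq_or_lt with rfl | h
    · rfl
    · exact (tangentAngle_lt_tangentAngle hx hy hz h).le
  refine (key hx hz h).trans ?_
  rw [tangentAngle_comm x', tangentAngle_comm x']
  exact key hz (hx.trans_le h) h'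

/-- The law of cosines determines the turn from E to F up to sign, and the orientation of the face
makes it counterclockwise. -/
lemma IsFace.tangentAt {P : Set Disc} {D E F : Disc} (h : IsFace P D E F) {θ : ℝ}
    (hθ : D.TangentAt E θ) :
    D.TangentAt F (θ + tangentAngle E.radius D.radius F.radius) := by
  have rD := D.radius_pos
  have rE := E.radius_pos
  have rF := F.radius_pos
  have hcs := Real.cos_sq_add_sin_sq θ
  have hdet := h.det_pos
  obtain ⟨φ, hφ⟩ := h.tangent₃₁.symm.exists_tangentAt
  set τ := tangentAngle E.radius D.radius F.radius with hτ
  -- the turn from `E` to `F`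
  have hsin : 0 < Real.sin (φ - θ) := by
    rw [hθ, hφ] at hdet
    simp only [planeDet, PiLp.add_apply, PiLp.sub_apply, PiLp.smul_apply, smul_eq_mul, dir_zero,
      dir_one] at hdet
    rw [Real.sin_sub]
    have : 0 < ((D.radius + E.radius) * (D.radius + F.radius)) *
      (Real.sin φ * Real.cos θ - Real.cos φ * Real.sin θ) := by
        refine lt_of_lt_of_eq hdet ?_; ring
    exact pos_of_mul_pos_right this (by positivity)
  have hcos : Real.cos (φ - θ) = Real.cos τ := by
    have h1 : dist E.center F.center ^ 2 = (E.radius + F.radius) ^ 2 := by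
      rw [h.tangent₂₃]
    rw [dist_sq_plane, hθ, hφ] at h1
    simp only [PiLp.add_apply, PiLp.smul_apply, smul_eq_mul, dir_zero, dir_one] at h1
    have hcsφ := Real.cos_sq_add_sin_sq φ
    rw [hτ, cos_tangentAngle rE rD rF, Real.cos_sub]
    field_simp
    linear_combination (-1 / 2 : ℝ) * h1 + (1 / 2) * (D.radius + E.radius) ^ 2 * hcs +
      (1 / 2) * (D.radius + F.radius) ^ 2 * hcsφ
  have hτ0 : 0 < τ := tangentAngle_pos rE rD rF
  have hτπ : τ < Real.pi := tangentAngle_lt_pi rE rD rF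
  have hsinτ : Real.sin (φ - θ) = Real.sin τ := by
    have hs := Real.sin_pos_of_pos_of_lt_pi hτ0 hτπ
    have h1 := Real.cos_sq_add_sin_sq τ
    have h2 := Real.cos_sq_add_sin_sq (φ - θ)
    rw [hcos] at h2
    nlinarith
  have hdir : dir (θ + τ) = dir φ := by
    have e : φ = θ + (φ - θ) := by ring
    apply plane_ext
    · rw [dir_zero, dir_zero, Real.cos_add, e, Real.cos_add θ (φ - θ), hcos, hsinτ]
    · rw [dir_one, dir_one, Real.sin_add, e, Real.sin_add θ (φ - θ), hcos, hsinτ]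
  unfold Disc.TangentAt at hφ ⊢
  rw [hdir, hφ]

lemma Disc.TangentAt.dir_eq {D E : Disc} {θ φ : ℝ} (h : D.TangentAt E θ) (h' : D.TangentAt E φ) :
    dir θ = dir φ := by
  have rD := D.radius_pos
  have rE := E.radius_pos
  have : D.center + (D.radius + E.radius) • dir θ = D.center + (D.radius + E.radius) • dir φ :=
    h.symm.trans h'
  exact smul_right_injective Plane (by positivity : D.radius + E.radius ≠ 0)
    (add_left_cancel this)

/-- No disc of the packing touches the first disc of a face strictly between the two others. -/
lemma IsFace.not_tangentAt {P : Set Disc} (hP : IsDiscPacking P) {D E F G : Disc}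
    (h : IsFace P D E F) (hG : G ∈ P) {θ t : ℝ} (hθ : D.TangentAt E θ) (ht0 : 0 < t)
    (ht : t < tangentAngle E.radius D.radius F.radius) : ¬ D.TangentAt G (θ + t) := by
  intro hDG
  have hF := h.tangentAt hθ
  have rD := D.radius_pos
  have rE := E.radius_pos
  have rF := F.radius_pos
  have rG := G.radius_pos
  have hτπ : tangentAngle E.radius D.radius F.radius < Real.pi := tangentAngle_lt_pi rE rD rF
  set τ := tangentAngle E.radius D.radius F.radius with hτ
  have hGE : E ≠ G := by
    rintro rfl
    have := dir_inj_of_lt (by linarith) (by linarith [Real.pi_pos]) (hθ.dir_eq hDG)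
    linarith
  have hGF : F ≠ G := by
    rintro rfl
    have := dir_inj_of_lt (by linarith) (by linarith [Real.pi_pos]) (hDG.dir_eq hF)
    linarith
  have hGD : D ≠ G := hDG.tangent.ne
  have hs : 0 < Real.sin τ := Real.sin_pos_of_pos_of_lt_pi (ht0.trans ht) hτπ
  have hs1 : 0 < Real.sin t := Real.sin_pos_of_pos_of_lt_pi ht0 (ht.trans hτπ)
  have hs2 : 0 < Real.sin (τ - t) := Real.sin_pos_of_pos_of_lt_pi (by linarith) (by linarith)
  -- The coefficients come from sin τ · dir (θ + t) = sin (τ - t) · dir θ + sin t · dir (θ + τ).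
  obtain ⟨a, b, ha, hb, hab⟩ : ∃ a b : ℝ, 0 < a ∧ 0 < b ∧
      dir (θ + t) = a • (E.center - D.center) + b • (F.center - D.center) := by
    refine ⟨Real.sin (τ - t) / (Real.sin τ * (D.radius + E.radius)),
      Real.sin t / (Real.sin τ * (D.radius + F.radius)), by positivity, by positivity, ?_⟩
    have hcsτ := Real.cos_sq_add_sin_sq τ
    rw [hθ, hF, add_sub_cancel_left, add_sub_cancel_left, smul_smul, smul_smul]
    have e1 : Real.sin (τ - t) / (Real.sin τ * (D.radius + E.radius)) * (D.radius + E.radius) =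
      Real.sin (τ - t) / Real.sin τ := by field_simp
    have e2 : Real.sin t / (Real.sin τ * (D.radius + F.radius)) * (D.radius + F.radius) =
      Real.sin t / Real.sin τ := by field_simp
    rw [e1, e2]
    apply plane_ext
    · simp only [PiLp.add_apply, PiLp.smul_apply, smul_eq_mul, dir_zero]
      field_simp
      rw [Real.sin_sub, Real.cos_add, Real.cos_add]
      ring
    · simp only [PiLp.add_apply, PiLp.smul_apply, smul_eq_mul, dir_one]
      field_simp
      rw [Real.sin_sub, Real.sin_add, Real.sin_add]
      ring
  have hab0 : 0 < a + b := by positivity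
  -- the point of the segment between the two other centres in the direction of `G`
  set m := (a + b)⁻¹ with hm
  have hmpos : 0 < m := by positivity
  have hma : m * a = 1 - m * b := by
    rw [hm]; field_simp; ring
  have hx : D.center + m • dir (θ + t) = E.center + (m * b) • (F.center - E.center) := by
    rw [hab, smul_add, smul_smul, smul_smul, hma]; module
  have hmb : m * b ≤ 1 := by
    have : 0 < m * a := by positivity
    linarith
  -- Along the ray towards G, the points at distance less than `D.radius + 2 * G.radius` lie inside
  -- D, inside G or at their contact, hence in no other disc. The side EF is thus met only beyond G,
  -- and the centre of G lies in the triangle.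
  have hnot : ∀ H ∈ P, H ≠ D → H ≠ G → D.center + m • dir (θ + t) ∈ H.carrier →
      D.radius + 2 * G.radius ≤ m := by
    intro H hH hHD hHG hxH
    by_contra! hlt
    rcases lt_trichotomy m D.radius with h1 | h1 | h1
    · refine hHD (hP.eq_of_mem hH h.mem₁ hxH ?_)
      rwa [dist_self_add_left, norm_smul, norm_dir, mul_one, Real.norm_of_nonneg hmpos.le]
    · rw [h1] at hxH
      rcases hP.eq_or_eq_of_mem_contact h.mem₁ hG hH hDG hxH with h2 | h2
      · exact hHD h2
      · exact hHG h2
    · refine hHG (hP.eq_of_mem hH hG hxH ?_)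
      rw [hDG, dist_add_left, dist_eq_norm, ← sub_smul, norm_smul, norm_dir, mul_one,
        Real.norm_eq_abs, abs_lt]
      constructor <;> linarith
  have hbig : D.radius + 2 * G.radius ≤ m := by
    rcases segment_subset_of_tangent h.tangent₂₃ (by positivity) hmb hx with h1 | h1
    · exact hnot E h.mem₂ h.tangent₁₂.symm.ne hGE h1
    · exact hnot F h.mem₃ h.tangent₃₁.ne hGF h1
  have hmem : G.center ∈ curvilinearTriangle D E F := by
    have hself : dist G.center G.center < G.radius := by rwa [dist_self]
    refine ⟨mem_convexHull_triple.2 ⟨(D.radius + G.radius) * a, (D.radius + G.radius) * b,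
      by positivity, by positivity, ?_, ?_⟩, ?_⟩
    · rw [← mul_add]
      have : (D.radius + G.radius) * (a + b) ≤ m * (a + b) :=
        mul_le_mul_of_nonneg_right (by linarith) hab0.le
      rwa [hm, inv_mul_cancel₀ hab0.ne'] at this
    · rw [hDG, hab, smul_add, smul_smul, smul_smul, add_assoc]
    · rintro ((h1 | h1) | h1)
      · exact hGD (hP.eq_of_mem h.mem₁ hG h1 hself)
      · exact hGE (hP.eq_of_mem h.mem₂ hG h1 hself)
      · exact hGF (hP.eq_of_mem h.mem₃ hG h1 hself)
  exact mem_uncovered.1 (h.subset hmem) G hG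
    (by rw [Disc.carrier, Metric.mem_closedBall, dist_self]; exact rG.le)

/-- Of two candidates, the one with the smaller angle would touch D strictly inside the face of the
other. -/
lemma IsFace.unique {P : Set Disc} (hP : IsDiscPacking P) {D E F G : Disc}
    (h : IsFace P D E F) (h' : IsFace P D E G) : F = G := by
  obtain ⟨θ, hθ⟩ := h.tangent₁₂.exists_tangentAt
  have pos : ∀ {F}, 0 < tangentAngle E.radius D.radius (Disc.radius F) := fun {F} =>
    tangentAngle_pos E.radius_pos D.radius_pos F.radius_pos
  rcases lt_trichotomy (tangentAngle E.radius D.radius F.radius)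
    (tangentAngle E.radius D.radius G.radius) with hlt | heq | hlt
  · exact absurd (h.tangentAt hθ) (h'.not_tangentAt hP h.mem₃ hθ pos hlt)
  · exact hP.eq_of_tangentAt h.mem₃ h'.mem₃ (h.tangentAt hθ) (heq ▸ h'.tangentAt hθ)
  · exact absurd (h'.tangentAt hθ) (h.not_tangentAt hP h'.mem₃ hθ pos hlt)

lemma IsFace.unique' {P : Set Disc} (hP : IsDiscPacking P) {D E F G : Disc}
    (h : IsFace P D F E) (h' : IsFace P D G E) : F = G :=
  h.rotate.rotate.unique hP h'.rotate.rotate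

/-! ### Turning around a disc -/

/-- The sequence of the discs met by turning around `D`. -/
def IsTurn (P : Set Disc) (D : Disc) (E : ℕ → Disc) : Prop := ∀ i, IsFace P D (E i) (E (i + 1))

/-- The angle between the discs `E 0` and `E n` of a sequence turning around `D`. -/
noncomputable def turnAngle (D : Disc) (E : ℕ → Disc) (n : ℕ) : ℝ :=
  ∑ i ∈ Finset.range n, tangentAngle (E i).radius D.radius (E (i + 1)).radius

lemma IsBoundedPacking.exists_turn {s : ℝ} {P : Set Disc} (hP : IsBoundedPacking s P)
    (hc : IsCompactPacking P) {D E₀ : Disc} (hD : D ∈ P) (hE : E₀ ∈ P) (hDE : D.Tangent E₀) :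
    ∃ E : ℕ → Disc, E 0 = E₀ ∧ IsTurn P D E := by
  have hnext : ∀ E : {E // E ∈ P ∧ D.Tangent E}, ∃ F : {E // E ∈ P ∧ D.Tangent E},
      IsFace P D E F := by
    rintro ⟨E, hE, hDE⟩
    obtain ⟨F, hF⟩ := hP.exists_face hc hD hE hDE
    exact ⟨⟨F, hF.mem₃, hF.tangent₃₁.symm⟩, hF⟩
  choose next hnext using hnext
  refine ⟨fun n => (next^[n] ⟨E₀, hE, hDE⟩ : {E // E ∈ P ∧ D.Tangent E}), rfl, fun i => ?_⟩
  simp only [Function.iterate_succ_apply']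
  exact hnext _

lemma IsTurn.tangentAt {P : Set Disc} {D : Disc} {E : ℕ → Disc} (h : IsTurn P D E) {θ : ℝ}
    (hθ : D.TangentAt (E 0) θ) (n : ℕ) : D.TangentAt (E n) (θ + turnAngle D E n) := by
  induction n with
  | zero => simpa [turnAngle] using hθ
  | succ n ih =>
    rw [turnAngle, Finset.sum_range_succ, ← add_assoc]
    exact (h n).tangentAt ih

lemma turnAngle_succ (D : Disc) (E : ℕ → Disc) (n : ℕ) : turnAngle D E (n + 1) =
    turnAngle D E n + tangentAngle (E n).radius D.radius (E (n + 1)).radius :=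
  Finset.sum_range_succ _ _

lemma turnAngle_strictMono (D : Disc) (E : ℕ → Disc) : StrictMono (turnAngle D E) :=
  strictMono_nat_of_lt_succ fun n => by
    rw [turnAngle_succ]
    linarith [tangentAngle_pos (E n).radius_pos D.radius_pos (E (n + 1)).radius_pos]

/-- By turning around a disc, one comes back to the initial disc after one full turn, having met
each disc of the corona once. -/
lemma IsTurn.exists_full_turn {s : ℝ} {P : Set Disc} (hP : IsBoundedPacking s P) {D : Disc}
    {E : ℕ → Disc} (h : IsTurn P D E) :
    ∃ n, turnAngle D E n = 2 * Real.pi ∧ E n = E 0 ∧ Set.InjOn E (Set.Iio n) ∧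
      ∀ G ∈ P, D.Tangent G → ∃ i < n, G = E i := by
  obtain ⟨θ, hθ⟩ := (h 0).tangent₁₂.exists_tangentAt
  have hat := h.tangentAt hθ
  have hmono := turnAngle_strictMono D E
  have hzero : turnAngle D E 0 = 0 := by simp [turnAngle]
  have hs := hP.pos
  have hsD := hP.le_radius D (h 0).mem₁
  -- the angles tend to infinity
  have hunb : ∀ x : ℝ, ∃ n, x < turnAngle D E n := by
    intro x
    have hlow : ∀ n : ℕ, n * tangentAngle s D.radius s ≤ turnAngle D E n := by
      intro n
      rw [turnAngle, ← nsmul_eq_mul, ← Finset.card_range n, ← Finset.sum_const,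
        Finset.card_range]
      exact Finset.sum_le_sum fun i _ => tangentAngle_mono hs D.radius_pos hs
        (hP.le_radius _ (h i).mem₂) (hP.le_radius _ (h i).mem₃)
    have hpos := tangentAngle_pos hs D.radius_pos hs
    obtain ⟨n, hn⟩ := exists_nat_gt (x / tangentAngle s D.radius s)
    rw [div_lt_iff₀ hpos] at hn
    exact ⟨n, hn.trans_le (hlow n)⟩
  -- a disc of the corona is met exactly
  have hmeet : ∀ G ∈ P, ∀ t, 0 ≤ t → D.TangentAt G (θ + t) → ∃ i, turnAngle D E i = t := by
    intro G hG t ht hGt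
    -- Take the last index k whose angle does not exceed t; a strict inequality would place G inside
    -- the face following E k.
    have hex := hunb t
    classical
    obtain ⟨k, hk⟩ : ∃ k, Nat.find hex = k + 1 := by
      refine Nat.exists_eq_succ_of_ne_zero fun h0 => ?_
      have := Nat.find_spec hex
      rw [h0, hzero] at this
      linarith
    have hlt := Nat.find_spec hex
    rw [hk, turnAngle_succ] at hlt
    have hle : turnAngle D E k ≤ t := not_lt.1 (Nat.find_min hex (by omega))
    refine ⟨k, hle.eq_of_not_lt fun hlt' => ?_⟩
    refine (h k).not_tangentAt hP.packing hG (hat k) (t := t - turnAngle D E k)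
      (by linarith) (by linarith) ?_
    convert hGt using 1
    ring
  -- The initial disc also lies in the direction θ + 2π, so the sequence must reach that angle
  -- exactly.
  obtain ⟨n, hn⟩ := hmeet (E 0) (h 0).mem₂ (2 * Real.pi) (by positivity) (by
    unfold Disc.TangentAt at hθ ⊢
    rw [dir_add_two_pi, ← hθ])
  refine ⟨n, hn, ?_, ?_, ?_⟩
  · refine hP.packing.eq_of_tangentAt (h n).mem₂ (h 0).mem₂ (hat n) ?_
    unfold Disc.TangentAt at hθ ⊢
    rw [hn, dir_add_two_pi, ← hθ]
  · have key : ∀ i j, i ≤ j → j < n → E i = E j → i = j := by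
      intro i j hij hj he
      have hi := hat i
      rw [he] at hi
      have hd := dir_inj_of_lt (by have := hmono.monotone hij; linarith) (by
        have h1 := hmono hj
        have h2 := hmono.monotone (Nat.zero_le i)
        linarith) (hi.dir_eq (hat j))
      exact hmono.injective (by linarith)
    intro i hi j hj he
    rcases le_total i j with hij | hij
    · exact key i j hij hj he
    · exact (key j i hij hi he.symm).symm
  · intro G hG hDG
    obtain ⟨φ, hφ⟩ := hDG.exists_tangentAt
    have hmem := toIcoMod_mem_Ico Real.two_pi_pos 0 (φ - θ)
    rw [zero_add] at hmem
    have hGt : D.TangentAt G (θ + toIcoMod Real.two_pi_pos 0 (φ - θ)) := by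
      unfold Disc.TangentAt at hφ ⊢
      have e : φ = θ + toIcoMod Real.two_pi_pos 0 (φ - θ) +
          (toIcoDiv Real.two_pi_pos 0 (φ - θ) : ℤ) * (2 * Real.pi) := by
        have := toIcoMod_add_toIcoDiv_zsmul Real.two_pi_pos 0 (φ - θ)
        rw [zsmul_eq_mul] at this
        linarith
      rw [e, dir_add_int_mul] at hφ
      exact hφ
    obtain ⟨i, hi⟩ := hmeet G hG _ hmem.1 hGt
    refine ⟨i, hmono.lt_iff_lt.1 (by rw [hi, hn]; exact hmem.2), ?_⟩
    rw [← hi] at hGt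
    exact hP.packing.eq_of_tangentAt hG (h i).mem₂ hGt (hat i)

/-! ### Connectedness of the contact graph -/

/-- The convex hull of the centres of three discs, together with these discs. -/
def tile (t : Disc × Disc × Disc) : Set Plane :=
  convexHull ℝ {t.1.center, t.2.1.center, t.2.2.center} ∪
    (t.1.carrier ∪ t.2.1.carrier ∪ t.2.2.carrier)

/-- Three times the same disc of `P`, or the three discs around an interstice of `P`. -/
structure IsTileOf (P : Set Disc) (t : Disc × Disc × Disc) : Prop where
  mem₁ : t.1 ∈ P
  mem₂ : t.2.1 ∈ P
  mem₃ : t.2.2 ∈ P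
  eq_or_tangent : (t.2.1 = t.1 ∧ t.2.2 = t.1) ∨ (t.1.Tangent t.2.1 ∧ t.1.Tangent t.2.2 ∧
    curvilinearTriangle t.1 t.2.1 t.2.2 ∈ interstices P)

lemma mem_interstice_eq {P : Set Disc} {I : Set Plane} (hI : I ∈ interstices P) {x : Plane}
    (hx : x ∈ I) : I = connectedComponentIn (uncovered P) x := by
  obtain ⟨p, -, rfl⟩ := hI
  exact connectedComponentIn_eq hx

lemma isClosed_tile (t : Disc × Disc × Disc) : IsClosed (tile t) :=
  (Set.Finite.isClosed_convexHull ℝ (by simp)).union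
    ((Metric.isClosed_closedBall.union Metric.isClosed_closedBall).union
      Metric.isClosed_closedBall)

lemma IsTileOf.mem {P : Set Disc} {t : Disc × Disc × Disc} (ht : IsTileOf P t) {x : Plane}
    (hx : x ∈ tile t) : (x ∈ t.1.carrier ∨ x ∈ t.2.1.carrier ∨ x ∈ t.2.2.carrier) ∨
      (x ∈ curvilinearTriangle t.1 t.2.1 t.2.2 ∧
        curvilinearTriangle t.1 t.2.1 t.2.2 ∈ interstices P) := by
  by_cases hc : x ∈ t.1.carrier ∪ t.2.1.carrier ∪ t.2.2.carrier
  · left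
    simpa only [Set.mem_union, or_assoc] using hc
  · have hx' := hx.resolve_right hc
    rcases ht.eq_or_tangent with ⟨h1, h2⟩ | ⟨-, -, h⟩
    · refine absurd ?_ hc
      rw [h1, h2] at hx'
      simp only [Set.insert_eq_of_mem, Set.mem_singleton_iff, convexHull_singleton] at hx'
      left; left
      rw [hx', Disc.carrier, Metric.mem_closedBall, dist_self]
      exact t.1.radius_pos.le
    · exact Or.inr ⟨⟨hx', hc⟩, h⟩

lemma IsBoundedPacking.isClosed_iUnion_tile {s : ℝ} {P : Set Disc} (hP : IsBoundedPacking s P)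
    {T : Set (Disc × Disc × Disc)} (hT : ∀ t ∈ T, IsTileOf P t) :
    IsClosed (⋃ t : T, tile t) := by
  refine LocallyFinite.isClosed_iUnion (fun x => ?_) fun t => isClosed_tile t
  refine ⟨Metric.ball x 1, Metric.ball_mem_nhds x one_pos, ?_⟩
  -- A tile meeting the unit ball around x has its first centre within 1 + 3 of x, and the other two
  -- within 2 of the first.
  have hfin := hP.finite_near x 6
  refine ((hfin.prod (hfin.prod hfin)).preimage (f := ((↑) : T → Disc × Disc × Disc))
    Subtype.val_injective.injOn).subset ?_
  rintro ⟨⟨A, B, C⟩, ht⟩ ⟨y, hy, hyx⟩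
  have hAB := hT _ ht
  obtain ⟨hA, hB, hC, hr⟩ := hAB
  simp only [tile] at hA hB hC hr hy
  have rA := hP.radius_le A hA
  have rB := hP.radius_le B hB
  have rC := hP.radius_le C hC
  have d : dist B.center A.center ≤ 2 ∧ dist C.center A.center ≤ 2 := by
    rcases hr with ⟨rfl, rfl⟩ | ⟨h1, h2, -⟩
    · simp
    · unfold Disc.Tangent at h1 h2
      rw [dist_comm B.center, dist_comm C.center, h1, h2]
      constructor <;> linarith
  have hyA : dist y A.center ≤ 3 := by
    rcases hy with h | (h | h) | h
    · have := convexHull_triple_subset_closedBall zero_le_two d.1 d.2 h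
      rw [Metric.mem_closedBall] at this
      linarith
    · have : dist y A.center ≤ A.radius := h
      linarith
    · have : dist y B.center ≤ B.radius := h
      linarith [dist_triangle y B.center A.center]
    · have : dist y C.center ≤ C.radius := h
      linarith [dist_triangle y C.center A.center]
  have hyx' : dist y x < 1 := hyx
  have hAx : dist A.center x ≤ 4 := by linarith [dist_triangle_left A.center x y]
  refine ⟨⟨hA, by linarith⟩, ⟨hB, ?_⟩, ⟨hC, ?_⟩⟩
  · linarith [dist_triangle B.center A.center x]
  · linarith [dist_triangle C.center A.center x]

/-- The contact graph of a compact packing is connected. -/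
lemma IsBoundedPacking.mem_of_tangent_closed {s : ℝ} {P : Set Disc} (hP : IsBoundedPacking s P)
    (hc : IsCompactPacking P) {C : Set Disc} (hCP : C ⊆ P) (hne : C.Nonempty)
    (hC : ∀ D ∈ C, ∀ E ∈ P, D.Tangent E → E ∈ C) {M : Disc} (hM : M ∈ P) : M ∈ C := by
  by_contra hMC
  -- The tiles of C and those of its complement cover the plane by two disjoint closed sets, so one
  -- of them is empty.
  set T₁ : Set (Disc × Disc × Disc) := {t | IsTileOf P t ∧ t.1 ∈ C ∧ t.2.1 ∈ C ∧ t.2.2 ∈ C}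
  -- The last clause assigns to `T₁` any interstice described by triples of both kinds, so it need
  -- not be shown that an interstice determines its discs.
  set T₂ : Set (Disc × Disc × Disc) := {t | IsTileOf P t ∧ t.1 ∉ C ∧ t.2.1 ∉ C ∧ t.2.2 ∉ C ∧
    ∀ u ∈ T₁, curvilinearTriangle u.1 u.2.1 u.2.2 ∈ interstices P →
      curvilinearTriangle t.1 t.2.1 t.2.2 ≠ curvilinearTriangle u.1 u.2.1 u.2.2}
  have hcl₁ := hP.isClosed_iUnion_tile (T := T₁) fun t ht => ht.1
  have hcl₂ := hP.isClosed_iUnion_tile (T := T₂) fun t ht => ht.1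
  have hsep : ∀ D ∈ C, ∀ E ∈ P, E ∉ C → ∀ x, x ∈ D.carrier → x ∈ E.carrier → False := by
    intro D hD E hE hEC x hxD hxE
    have hDE : D ≠ E := fun h => hEC (h ▸ hD)
    exact hEC (hC D hD E hE (hP.packing.tangent_of_mem (hCP hD) hE hxD hxE hDE))
  have hdisc : ∀ D ∈ P, D.center ∈ tile (D, D, D) ∧ IsTileOf P (D, D, D) := fun D hD =>
    ⟨Or.inl (subset_convexHull ℝ _ (by simp)), hD, hD, hD, Or.inl ⟨rfl, rfl⟩⟩
  have htri : ∀ D : Disc, curvilinearTriangle D D D = ∅ := by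
    intro D
    ext x
    simp only [curvilinearTriangle, Set.insert_eq_of_mem, Set.mem_singleton_iff,
      convexHull_singleton, Set.union_self, Set.mem_sdiff, Set.mem_empty_iff_false, iff_false,
      not_and, not_not]
    rintro rfl
    rw [Disc.carrier, Metric.mem_closedBall, dist_self]
    exact D.radius_pos.le
  have hdisc₂ : ∀ D ∈ P, D ∉ C → (D, D, D) ∈ T₂ := by
    intro D hD hDC
    refine ⟨(hdisc D hD).2, hDC, hDC, hDC, fun u _ hu h => ?_⟩
    obtain ⟨p, hp, hI⟩ := hu
    have := mem_connectedComponentIn hp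
    rw [← hI, ← h, htri] at this
    exact this
  have hdisj : Disjoint (⋃ t : T₁, tile t) (⋃ t : T₂, tile t) := by
    rw [Set.disjoint_left]
    intro x hx₁ hx₂
    rw [Set.mem_iUnion] at hx₁ hx₂
    obtain ⟨⟨t, ht, htA, htB, htC⟩, hxt⟩ := hx₁
    obtain ⟨⟨u, hu, huA, huB, huC, hu'⟩, hxu⟩ := hx₂
    have hcov : ∀ D ∈ P, x ∈ D.carrier → ∀ {I}, x ∈ I → I ∈ interstices P → False :=
      fun D hD hxD I hxI hI => mem_uncovered.1 (mem_interstice_subset hI hxI) D hD hxD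
    have ht₁ : (∃ D ∈ C, x ∈ D.carrier) ∨ _ := (ht.mem hxt).imp_left fun h => by
      rcases h with h | h | h
      exacts [⟨_, htA, h⟩, ⟨_, htB, h⟩, ⟨_, htC, h⟩]
    have hu₁ : (∃ D ∈ P, D ∉ C ∧ x ∈ D.carrier) ∨ _ := (hu.mem hxu).imp_left fun h => by
      rcases h with h | h | h
      exacts [⟨_, hu.mem₁, huA, h⟩, ⟨_, hu.mem₂, huB, h⟩, ⟨_, hu.mem₃, huC, h⟩]
    rcases ht₁ with ⟨D, hD, hxD⟩ | ⟨hxI, hI⟩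
    · rcases hu₁ with ⟨E, hE, hEC, hxE⟩ | ⟨hxJ, hJ⟩
      · exact hsep D hD E hE hEC x hxD hxE
      · exact hcov D (hCP hD) hxD hxJ hJ
    · rcases hu₁ with ⟨E, hE, -, hxE⟩ | ⟨hxJ, hJ⟩
      · exact hcov E hE hxE hxI hI
      · exact hu' t ⟨ht, htA, htB, htC⟩ hI
          ((mem_interstice_eq hJ hxJ).trans (mem_interstice_eq hI hxI).symm)
  have hcover : (⋃ t : T₁, tile t) ∪ (⋃ t : T₂, tile t) = Set.univ := by
    rw [Set.eq_univ_iff_forall]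
    intro x
    by_cases hx : x ∈ uncovered P
    · have hI : connectedComponentIn (uncovered P) x ∈ interstices P := ⟨x, hx, rfl⟩
      obtain ⟨A, hA, B, hB, D, hD, hAB, hBD, hDA, he⟩ := hc.triangulated _ hI
      have hxI := mem_connectedComponentIn hx
      rw [he] at hxI hI
      have ht : IsTileOf P (A, B, D) := ⟨hA, hB, hD, Or.inr ⟨hAB, hDA.symm, hI⟩⟩
      by_cases hAC : A ∈ C
      · left
        exact Set.mem_iUnion.2 ⟨⟨(A, B, D), ht, hAC, hC A hAC B hB hAB,
          hC A hAC D hD hDA.symm⟩, Or.inl hxI.1⟩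
      · by_cases hex : ∃ u ∈ T₁,
          curvilinearTriangle A B D = curvilinearTriangle u.1 u.2.1 u.2.2
        · left
          obtain ⟨u, hu, hue⟩ := hex
          rw [hue] at hxI
          exact Set.mem_iUnion.2 ⟨⟨u, hu⟩, Or.inl hxI.1⟩
        · right
          refine Set.mem_iUnion.2 ⟨⟨(A, B, D), ht, hAC, fun h => hAC (hC B h A hA hAB.symm),
            fun h => hAC (hC D h A hA hDA), fun u hu _ h => hex ⟨u, hu, h⟩⟩, Or.inl hxI.1⟩
    · simp only [mem_uncovered, not_forall, not_not] at hx
      obtain ⟨D, hD, hxD⟩ := hx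
      by_cases hDC : D ∈ C
      · exact Or.inl (Set.mem_iUnion.2 ⟨⟨(D, D, D), (hdisc D hD).2, hDC, hDC, hDC⟩,
          Or.inr (Or.inl (Or.inl hxD))⟩)
      · exact Or.inr (Set.mem_iUnion.2 ⟨⟨(D, D, D), hdisc₂ D hD hDC⟩,
          Or.inr (Or.inl (Or.inl hxD))⟩)
  have hcompl : (⋃ t : T₁, tile t)ᶜ = ⋃ t : T₂, tile t :=
    (IsCompl.of_eq (Set.disjoint_iff_inter_eq_empty.1 hdisj) hcover).compl_eq
  have hclopen : IsClopen (⋃ t : T₁, tile t) :=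
    ⟨hcl₁, by rw [← isClosed_compl_iff, hcompl]; exact hcl₂⟩
  obtain ⟨D, hD⟩ := hne
  rcases isClopen_iff.1 hclopen with h | h
  · have : D.center ∈ ⋃ t : T₁, tile t :=
      Set.mem_iUnion.2 ⟨⟨(D, D, D), (hdisc D (hCP hD)).2, hD, hD, hD⟩, (hdisc D (hCP hD)).1⟩
    rw [h] at this
    exact this
  · have : M.center ∈ ⋃ t : T₂, tile t :=
      Set.mem_iUnion.2 ⟨⟨(M, M, M), hdisc₂ M hM hMC⟩, (hdisc M hM).1⟩
    rw [← hcompl, h] at this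
    exact this (Set.mem_univ _)

/-! ### The angles of the small coronas -/

lemma lt_of_cos_lt_cos {a b : ℝ} (ha : a ≤ Real.pi) (hb : 0 ≤ b)
    (h : Real.cos b < Real.cos a) : a < b := by
  by_contra! hc
  exact absurd (Real.cos_le_cos_of_nonneg_of_le_pi hb ha hc) (not_le.2 h)

lemma cos_five_pi_div_twelve_mem :
    Real.cos (5 * Real.pi / 12) ∈ Set.Ioo (0.2588 : ℝ) 0.25883 := by
  have h : Real.cos (5 * Real.pi / 12) = √2 * (√3 - 1) / 4 := by
    rw [show 5 * Real.pi / 12 = Real.pi / 4 + Real.pi / 6 by ring, Real.cos_add,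
      Real.cos_pi_div_four, Real.cos_pi_div_six, Real.sin_pi_div_four, Real.sin_pi_div_six]
    ring
  have h2a : (1.41421 : ℝ) < √2 := Real.lt_sqrt_of_sq_lt (by norm_num)
  have h2b : √2 < (1.41422 : ℝ) := (Real.sqrt_lt' (by norm_num)).2 (by norm_num)
  have h3a : (1.73205 : ℝ) < √3 := Real.lt_sqrt_of_sq_lt (by norm_num)
  have h3b : √3 < (1.73206 : ℝ) := (Real.sqrt_lt' (by norm_num)).2 (by norm_num)
  rw [h]
  constructor <;> nlinarith

lemma cos_three_pi_div_eight_mem :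
    Real.cos (3 * Real.pi / 8) ∈ Set.Ioo (0.38 : ℝ) 0.3827 := by
  have h : Real.cos (3 * Real.pi / 8) = √(2 - √2) / 2 := by
    rw [← Real.sin_pi_div_eight, ← Real.cos_pi_div_two_sub]
    congr 1
    ring
  have h2a : (1.41421 : ℝ) < √2 := Real.lt_sqrt_of_sq_lt (by norm_num)
  have h2b : √2 < (1.41422 : ℝ) := (Real.sqrt_lt' (by norm_num)).2 (by norm_num)
  have ha : (0.76 : ℝ) < √(2 - √2) := Real.lt_sqrt_of_sq_lt (by norm_num; linarith)
  have hb : √(2 - √2) < (0.7654 : ℝ) := (Real.sqrt_lt' (by norm_num)).2 (by norm_num; linarith)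
  rw [h]
  constructor <;> linarith

lemma lt_cos_eleven_pi_div_twentyfour : (0.13 : ℝ) < Real.cos (11 * Real.pi / 24) := by
  rw [show 11 * Real.pi / 24 = Real.pi / 2 - Real.pi / 24 by ring, Real.cos_pi_div_two_sub]
  have h1 := Real.pi_gt_d2
  have h2 := Real.pi_lt_d2
  have h := Real.sin_gt_sub_cube (x := Real.pi / 24) (by positivity)
  have h3 : (Real.pi / 24) ^ 3 ≤ (3.15 / 24) ^ 3 :=
    pow_le_pow_left₀ (by positivity) (by linarith) 3
  norm_num at h3
  linarith

lemma tangentAngle_self {x : ℝ} (hx : 0 < x) : tangentAngle x x x = Real.pi / 3 := by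
  rw [tangentAngle_eq hx hx hx, ← Real.arccos_cos (x := Real.pi / 3) (by positivity)
    (by linarith [Real.pi_pos]), Real.cos_pi_div_three]
  congr 1
  field_simp
  norm_num

lemma tangentAngle_one_small {s : ℝ} (hs : 0 < s) (h₂ : CoronaCompatible s [1, s, 1, s, s]) :
    tangentAngle 1 s s = 5 * Real.pi / 12 := by
  have h : coronaAngleSum s [1, s, 1, s, s] = 2 * Real.pi := h₂
  simp [coronaAngleSum] at h
  rw [tangentAngle_self hs, tangentAngle_comm s s 1] at h
  linarith

lemma small_radius_mem {s : ℝ} (hs : 0 < s) (h₂ : CoronaCompatible s [1, s, 1, s, s]) :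
    s ∈ Set.Ioo (0.349 : ℝ) 0.3495 := by
  have h := cos_tangentAngle one_pos hs hs
  rw [tangentAngle_one_small hs h₂] at h
  obtain ⟨ha, hb⟩ := cos_five_pi_div_twelve_mem
  rw [h] at ha hb
  have e : 1 - 2 * (1 / (1 + s)) * (s / (s + s)) = s / (1 + s) := by field_simp; ring
  rw [e] at ha hb
  rw [lt_div_iff₀ (by positivity)] at ha
  rw [div_lt_iff₀ (by positivity)] at hb
  constructor <;> linarith

lemma tangentAngle_one_one_bounds {s : ℝ} (hs : 0 < s)
    (h₂ : CoronaCompatible s [1, s, 1, s, s]) :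
    Real.pi / 2 < tangentAngle 1 s 1 ∧ tangentAngle 1 s 1 < 7 * Real.pi / 12 := by
  obtain ⟨ha, hb⟩ := small_radius_mem hs h₂
  have hpi := Real.pi_pos
  have hc := cos_tangentAngle one_pos hs one_pos
  have hc' : Real.cos (tangentAngle 1 s 1) = 1 - 2 / (1 + s) ^ 2 := by
    rw [hc]; field_simp
  constructor
  · apply lt_of_cos_lt_cos (by linarith) (tangentAngle_pos one_pos hs one_pos).le
    rw [hc', Real.cos_pi_div_two, sub_neg, lt_div_iff₀ (by positivity)]
    nlinarith
  · apply lt_of_cos_lt_cos (tangentAngle_lt_pi one_pos hs one_pos).le (by positivity)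
    rw [show 7 * Real.pi / 12 = Real.pi - 5 * Real.pi / 12 by ring, Real.cos_pi_sub, hc']
    have h1 := cos_five_pi_div_twelve_mem.1
    have h2 : 2 / (1 + s) ^ 2 < 1.2 := by
      rw [div_lt_iff₀ (by positivity)]; nlinarith
    linarith

section

variable {r s : ℝ}

lemma two_mul_tangentAngle_add (hs : 0 < s)
    (h₁ : CoronaCompatible s [1, s, r, r, s]) (h₂ : CoronaCompatible s [1, s, 1, s, s]) :
    2 * tangentAngle r s s + tangentAngle r s r = 7 * Real.pi / 6 := by
  have h : coronaAngleSum s [1, s, r, r, s] = 2 * Real.pi := h₁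
  simp [coronaAngleSum] at h
  rw [tangentAngle_comm s s 1, tangentAngle_comm s s r, tangentAngle_one_small hs h₂] at h
  linarith

lemma cos_tangentAngle_small (hs : 0 < s) (hr : 0 < r) :
    Real.cos (tangentAngle r s s) = 1 - r / (r + s) := by
  rw [cos_tangentAngle hr hs hs]
  field_simp
  ring

/-- Both `rss` and `rsr` increase with r / (r + s), and 2 · 3π/8 + 5π/12 = 7π/6: if `rss` exceeded
3π/8, then `rsr` would exceed 5π/12 and the sum would be too large. -/
lemma tangentAngle_medium_small_le (hs : 0 < s) (hr : 0 < r)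
    (h₁ : CoronaCompatible s [1, s, r, r, s]) (h₂ : CoronaCompatible s [1, s, 1, s, s]) :
    tangentAngle r s s ≤ 3 * Real.pi / 8 := by
  by_contra! hlt
  have hsum := two_mul_tangentAngle_add hs h₁ h₂
  have hpi := Real.pi_pos
  have hc := Real.cos_lt_cos_of_nonneg_of_le_pi (by positivity)
    (tangentAngle_lt_pi hr hs hs).le hlt
  rw [cos_tangentAngle_small hs hr] at hc
  have h3 := cos_three_pi_div_eight_mem.2
  have h5 := cos_five_pi_div_twelve_mem.1
  have hu : 0.6173 < r / (r + s) := by linarith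
  have : 5 * Real.pi / 12 < tangentAngle r s r := by
    apply lt_of_cos_lt_cos (by linarith) (tangentAngle_pos hr hs hr).le
    rw [cos_tangentAngle hr hs hr]
    nlinarith
  linarith

/-- For a smaller r, both `rss` < 3π/8 and `rsr` < 5π/12, and the sum 7π/6 is not reached. -/
lemma half_le_medium_radius (hs : 0 < s) (hr : 0 < r)
    (h₁ : CoronaCompatible s [1, s, r, r, s]) (h₂ : CoronaCompatible s [1, s, 1, s, s]) :
    1 / 2 ≤ r := by
  by_contra! hlt
  have hsum := two_mul_tangentAngle_add hs h₁ h₂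
  obtain ⟨ha, hb⟩ := small_radius_mem hs h₂
  have hpi := Real.pi_pos
  have h3 := cos_three_pi_div_eight_mem.2
  have h5 := cos_five_pi_div_twelve_mem.2
  have hu0 : 0 < r / (r + s) := by positivity
  have hu : r / (r + s) < 0.59 := by
    rw [div_lt_iff₀ (by positivity)]; linarith
  have t1 : tangentAngle r s s < 3 * Real.pi / 8 := by
    apply lt_of_cos_lt_cos (tangentAngle_lt_pi hr hs hs).le (by positivity)
    rw [cos_tangentAngle_small hs hr]
    linarith
  have t2 : tangentAngle r s r < 5 * Real.pi / 12 := by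
    apply lt_of_cos_lt_cos (tangentAngle_lt_pi hr hs hr).le (by positivity)
    rw [cos_tangentAngle hr hs hr]
    nlinarith
  linarith

lemma tangentAngle_one_medium_lt (hs : 0 < s) (hr : 0 < r)
    (h₁ : CoronaCompatible s [1, s, r, r, s]) (h₂ : CoronaCompatible s [1, s, 1, s, s]) :
    tangentAngle 1 s r < Real.pi / 2 := by
  obtain ⟨ha, hb⟩ := small_radius_mem hs h₂
  have hpi := Real.pi_pos
  have hle := Real.cos_le_cos_of_nonneg_of_le_pi (tangentAngle_pos hr hs hs).le (by linarith)
    (tangentAngle_medium_small_le hs hr h₁ h₂)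
  rw [cos_tangentAngle_small hs hr] at hle
  have h3 := cos_three_pi_div_eight_mem.1
  apply lt_of_cos_lt_cos (tangentAngle_lt_pi one_pos hs hr).le (by positivity)
  rw [cos_tangentAngle one_pos hs hr, Real.cos_pi_div_two]
  have hu0 : 0 < r / (r + s) := by positivity
  have h1 : 1 / (1 + s) < 0.75 := by
    rw [div_lt_iff₀ (by positivity)]; linarith
  have h0 : 0 < 1 / (1 + s) := by positivity
  nlinarith

/-- By the relation 2 · `rss` + `rsr` = 7π/6, the sum equals `1sr` + 7π/6 - `rss`. Since `rss` ≤
3π/8, it is enough that `1sr` > 11π/24. -/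
lemma lt_angle_sum_one_medium_medium_small (hs : 0 < s) (hr : 0 < r)
    (h₁ : CoronaCompatible s [1, s, r, r, s]) (h₂ : CoronaCompatible s [1, s, 1, s, s]) :
    5 * Real.pi / 4 < tangentAngle 1 s r + tangentAngle r s r + tangentAngle r s s := by
  obtain ⟨ha, hb⟩ := small_radius_mem hs h₂
  have hpi := Real.pi_pos
  have hsum := two_mul_tangentAngle_add hs h₁ h₂
  have hle := tangentAngle_medium_small_le hs hr h₁ h₂
  have hr2 := half_le_medium_radius hs hr h₁ h₂
  have : 11 * Real.pi / 24 < tangentAngle 1 s r := by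
    apply lt_of_cos_lt_cos (by linarith) (tangentAngle_pos one_pos hs hr).le
    refine lt_trans ?_ lt_cos_eleven_pi_div_twentyfour
    rw [cos_tangentAngle one_pos hs hr]
    have hu : 0.5885 < r / (r + s) := by
      rw [lt_div_iff₀ (by positivity)]; linarith
    have h1 : 0.741 < 1 / (1 + s) := by
      rw [lt_div_iff₀ (by positivity)]; linarith
    nlinarith
  linarith

end

/-! ### Propagation of the corona `1s1ss` -/

/-- The small disc `S` of `P` is surrounded by the faces of a corona coded by `1s1ss`. -/
def HasSeparatedCorona (P : Set Disc) (s : ℝ) (S : Disc) : Prop :=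
  S.radius = s ∧ ∃ A a B b c : Disc,
    (A.radius = 1 ∧ a.radius = s ∧ B.radius = 1 ∧ b.radius = s ∧ c.radius = s) ∧
    IsFace P S A a ∧ IsFace P S a B ∧ IsFace P S B b ∧ IsFace P S b c ∧ IsFace P S c A

lemma IsThreeSizePacking.isBoundedPacking {r s : ℝ} {P : Set Disc} (hP : IsThreeSizePacking r s P)
    (hs : 0 < s) (hsr : s < r) (hr : r < 1) : IsBoundedPacking s P where
  packing := hP.compact.packing
  pos := hs
  le_radius D hD := by rcases hP.radii D hD with h | h | h <;> rw [h] <;> linarith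
  radius_le D hD := by rcases hP.radii D hD with h | h | h <;> rw [h] <;> linarith

section

variable {r s : ℝ} {P : Set Disc}

/-- In a turn around a small disc which is met by a large disc and whose first two angles are not
too large, the corona has five discs. -/
lemma IsTurn.eq_five (hs : 0 < s) (hP : IsBoundedPacking s P)
    (h₂ : CoronaCompatible s [1, s, 1, s, s]) {D : Disc} (hD : D.radius = s) {E : ℕ → Disc}
    (h : IsTurn P D E) (hE : (E 0).radius = 1 ∨ (E 2).radius = 1)
    (htwo : turnAngle D E 2 ≤ 5 * Real.pi / 6) :
    turnAngle D E 5 = 2 * Real.pi ∧ E 5 = E 0 := by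
  obtain ⟨n, hn, hn0, -, -⟩ := h.exists_full_turn hP
  have hmono := (turnAngle_strictMono D E).monotone
  have h11 := (tangentAngle_one_one_bounds hs h₂).2
  have hpi := Real.pi_pos
  have hle : ∀ i, s ≤ (E i).radius := fun i => hP.le_radius _ (h i).mem₂
  have hge : ∀ i, (E i).radius ≤ 1 := fun i => hP.radius_le _ (h i).mem₂
  have hlow : ∀ i, Real.pi / 3 ≤ tangentAngle (E i).radius s (E (i + 1)).radius := fun i => by
    rw [← tangentAngle_self hs]
    exact tangentAngle_mono hs hs hs (hle i) (hle _)
  have hup : ∀ i, tangentAngle (E i).radius s (E (i + 1)).radius ≤ tangentAngle 1 s 1 := fun i =>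
    tangentAngle_mono (E i).radius_pos hs (E _).radius_pos (hge i) (hge _)
  have hone : ∀ i, (E i).radius = 1 →
      5 * Real.pi / 12 ≤ tangentAngle (E i).radius s (E (i + 1)).radius := fun i hi => by
    rw [← tangentAngle_one_small hs h₂, hi]
    exact tangentAngle_mono one_pos hs hs le_rfl (hle _)
  have hone' : ∀ i, (E (i + 1)).radius = 1 →
      5 * Real.pi / 12 ≤ tangentAngle (E i).radius s (E (i + 1)).radius := fun i hi => by
    rw [← tangentAngle_one_small hs h₂, hi, tangentAngle_comm 1]
    exact tangentAngle_mono hs hs one_pos (hle _) le_rfl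
  have h0 : turnAngle D E 0 = 0 := by simp [turnAngle]
  have hsucc := turnAngle_succ D E
  rw [hD] at hsucc
  have s0 := hsucc 0
  have s1 := hsucc 1
  have s2 := hsucc 2
  have s3 := hsucc 3
  have s4 := hsucc 4
  have s5 := hsucc 5
  norm_num at s0 s1 s2 s3 s4 s5
  have l0 := hlow 0
  have l1 := hlow 1
  have l2 := hlow 2
  have l3 := hlow 3
  have l4 := hlow 4
  have l5 := hlow 5
  norm_num at l0 l1 l2 l3 l4 l5
  -- Four angles add up to less than 5π/6 + 2 · 7π/12 = 2π.
  have hn4 : ¬ n ≤ 4 := by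
    intro h4
    have := hmono h4
    have u2 := hup 2
    have u3 := hup 3
    norm_num at u2 u3
    linarith
  -- The large disc borders two angles of at least 5π/12; four others of at least π/3 bring the
  -- total to 13π/6. When the large disc is `E 0`, one of its two angles is the last of the turn.
  have hn6 : ¬ 6 ≤ n := by
    intro h6
    rcases hE with hE | hE
    · obtain ⟨m, rfl⟩ : ∃ m, n = m + 1 := ⟨n - 1, by omega⟩
      have h5 := hmono (show 5 ≤ m by omega)
      have h1 := hone' m (by rw [hn0, hE])
      have h2 := hone 0 hE
      have h3 := hsucc m
      norm_num at h2
      linarith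
    · have := hmono h6
      have h1 := hone' 1 hE
      have h2 := hone 2 hE
      norm_num at h1 h2
      linarith
  obtain rfl : n = 5 := by omega
  exact ⟨hn, hn0⟩

/-- The angles of a turn around a small disc. -/
lemma turnAngle_five {D : Disc} (hD : D.radius = s) (E : ℕ → Disc) :
    turnAngle D E 5 = tangentAngle (E 0).radius s (E 1).radius +
      tangentAngle (E 1).radius s (E 2).radius + tangentAngle (E 2).radius s (E 3).radius +
      tangentAngle (E 3).radius s (E 4).radius + tangentAngle (E 4).radius s (E 5).radius := by
  simp [turnAngle, Finset.sum_range_succ, hD]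

lemma turnAngle_two {D : Disc} (hD : D.radius = s) (E : ℕ → Disc) :
    turnAngle D E 2 = tangentAngle (E 0).radius s (E 1).radius +
      tangentAngle (E 1).radius s (E 2).radius := by
  simp [turnAngle, Finset.sum_range_succ, hD]

/-- If three angles around a small disc from a large disc to a large one complete two angles
between a small and a large disc, then the two discs in between are small. -/
lemma eq_small_of_angle_sum_one_one (hs : 0 < s) (hsr : s < r)
    (h₂ : CoronaCompatible s [1, s, 1, s, s]) {x y : ℝ}
    (hx : x = 1 ∨ x = r ∨ x = s) (hy : y = 1 ∨ y = r ∨ y = s)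
    (h : tangentAngle 1 s x + tangentAngle x s y + tangentAngle y s 1 = 7 * Real.pi / 6) :
    x = s ∧ y = s := by
  have hr := hs.trans hsr
  have hpi := Real.pi_pos
  have t11 := (tangentAngle_one_one_bounds hs h₂).1
  have t1s := tangentAngle_one_small hs h₂
  have tss := tangentAngle_self hs
  have t1r : tangentAngle s s 1 < tangentAngle r s 1 :=
    tangentAngle_lt_tangentAngle hs hs one_pos hsr
  have trs : tangentAngle s s s < tangentAngle r s s :=
    tangentAngle_lt_tangentAngle hs hs hs hsr
  have trr : tangentAngle s s r < tangentAngle r s r :=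
    tangentAngle_lt_tangentAngle hs hs hr hsr
  have c1 := tangentAngle_comm 1 s s
  have c2 := tangentAngle_comm 1 s r
  have c3 := tangentAngle_comm r s s
  -- The value 7π/6 = 5π/12 + π/3 + 5π/12 is the strict minimum, attained only by two small discs.
  rcases hx with rfl | rfl | rfl <;> rcases hy with rfl | rfl | rfl <;>
    first
    | exact ⟨rfl, rfl⟩
    | (exfalso; linarith)

/-- If three angles around a small disc from a large disc to a small one complete an angle between
a small and a large disc and one between two small discs, then the two discs in between are a small
and a large one. -/
lemma eq_small_large_of_angle_sum_one_small (hs : 0 < s) (hsr : s < r)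
    (h₁ : CoronaCompatible s [1, s, r, r, s]) (h₂ : CoronaCompatible s [1, s, 1, s, s])
    {x y : ℝ} (hx : x = 1 ∨ x = r ∨ x = s) (hy : y = 1 ∨ y = r ∨ y = s)
    (h : tangentAngle 1 s x + tangentAngle x s y + tangentAngle y s s = 5 * Real.pi / 4) :
    x = s ∧ y = 1 := by
  have hr := hs.trans hsr
  have hpi := Real.pi_pos
  have t11 := (tangentAngle_one_one_bounds hs h₂).1
  have t1s := tangentAngle_one_small hs h₂
  have tss := tangentAngle_self hs
  have t1r : tangentAngle s s 1 < tangentAngle r s 1 :=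
    tangentAngle_lt_tangentAngle hs hs one_pos hsr
  have trs : tangentAngle s s s < tangentAngle r s s :=
    tangentAngle_lt_tangentAngle hs hs hs hsr
  have c1 := tangentAngle_comm 1 s s
  have c2 := tangentAngle_comm 1 s r
  have c3 := tangentAngle_comm r s s
  have k1 := tangentAngle_one_medium_lt hs hr h₁ h₂
  have k2 := tangentAngle_medium_small_le hs hr h₁ h₂
  have k3 := lt_angle_sum_one_medium_medium_small hs hr h₁ h₂
  -- The pairs (s, s), (s, r) and (r, s) give too small a sum, while (r, r), (r, 1) and those with x
  -- = 1 give too large a one. The order (1, s) is excluded by `1s1` > π/2.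
  rcases hx with rfl | rfl | rfl <;> rcases hy with rfl | rfl | rfl <;>
    first
    | exact ⟨rfl, rfl⟩
    | (exfalso; linarith)

lemma HasSeparatedCorona.mem {S : Disc} (h : HasSeparatedCorona P s S) : S ∈ P := by
  obtain ⟨-, A, a, B, b, c, -, h0, -⟩ := h
  exact h0.mem₁

/-- The corona of a disc with five consecutive faces. -/
lemma eq_of_five_faces (hP : IsBoundedPacking s P) (hc : IsCompactPacking P)
    {S A a B b c : Disc} (h0 : IsFace P S A a) (h1 : IsFace P S a B) (h2 : IsFace P S B b)
    (h3 : IsFace P S b c) (h4 : IsFace P S c A) {G : Disc} (hG : G ∈ P) (hSG : S.Tangent G) :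
    G = A ∨ G = a ∨ G = B ∨ G = b ∨ G = c := by
  obtain ⟨E, hE0, hE⟩ := hP.exists_turn hc h0.mem₁ h0.mem₂ h0.tangent₁₂
  obtain ⟨n, -, -, -, hcov⟩ := hE.exists_full_turn hP
  have key : ∀ i, E i = A ∨ E i = a ∨ E i = B ∨ E i = b ∨ E i = c := by
    intro i
    induction i with
    | zero => exact Or.inl hE0
    | succ i ih =>
      have hi := hE i
      rcases ih with h | h | h | h | h <;> rw [h] at hi
      · exact Or.inr (Or.inl (hi.unique hP.packing h0))
      · exact Or.inr (Or.inr (Or.inl (hi.unique hP.packing h1)))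
      · exact Or.inr (Or.inr (Or.inr (Or.inl (hi.unique hP.packing h2))))
      · exact Or.inr (Or.inr (Or.inr (Or.inr (hi.unique hP.packing h3))))
      · exact Or.inl (hi.unique hP.packing h4)
  obtain ⟨i, -, rfl⟩ := hcov G hG hSG
  exact key i

/-- The turn around a disc that starts with two given consecutive faces. -/
lemma exists_turn_of_faces (hP : IsBoundedPacking s P) (hc : IsCompactPacking P)
    {D E F G : Disc} (h : IsFace P D E F) (h' : IsFace P D F G) :
    ∃ E' : ℕ → Disc, E' 0 = E ∧ E' 1 = F ∧ E' 2 = G ∧ IsTurn P D E' := by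
  obtain ⟨E', h0, hE⟩ := hP.exists_turn hc h.mem₁ h.mem₂ h.tangent₁₂
  have e1 : E' 1 = F := by
    have := hE 0
    rw [h0] at this
    exact this.unique hP.packing h
  have e2 : E' 2 = G := by
    have := hE 1
    rw [e1] at this
    exact this.unique hP.packing h'
  exact ⟨E', h0, e1, e2, hE⟩

variable (hs : 0 < s) (hsr : s < r) (hr : r < 1)
  (h₁ : CoronaCompatible s [1, s, r, r, s]) (h₂ : CoronaCompatible s [1, s, 1, s, s])
  (hP : IsThreeSizePacking r s P)

include hs hsr hr h₂ hP in
lemma hasSeparatedCorona_of_large_small_large {D E F G : Disc} (hD : D.radius = s)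
    (h : IsFace P D E F) (h' : IsFace P D F G) (hE : E.radius = 1) (hF : F.radius = s)
    (hG : G.radius = 1) : HasSeparatedCorona P s D := by
  have hB := hP.isBoundedPacking hs hsr hr
  obtain ⟨T, rfl, rfl, rfl, hT⟩ := exists_turn_of_faces hB hP.compact h h'
  have t1s := tangentAngle_one_small hs h₂
  have hsum := hT.eq_five hs hB h₂ hD (Or.inl hE) (by
    rw [turnAngle_two hD, hE, hF, hG, tangentAngle_comm s s 1, t1s]; linarith)
  obtain ⟨hsum, h5⟩ := hsum
  rw [turnAngle_five hD, h5, hE, hF, hG, tangentAngle_comm s s 1, t1s] at hsum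
  obtain ⟨e3, e4⟩ := eq_small_of_angle_sum_one_one hs hsr h₂ (hP.radii _ (hT 3).mem₂)
    (hP.radii _ (hT 4).mem₂) (by linarith)
  exact ⟨hD, T 0, T 1, T 2, T 3, T 4, ⟨hE, hF, hG, e3, e4⟩, hT 0, hT 1, hT 2, hT 3,
    h5 ▸ hT 4⟩

include hs hsr hr h₁ h₂ hP in
lemma hasSeparatedCorona_of_small_small_large {D E F G : Disc} (hD : D.radius = s)
    (h : IsFace P D E F) (h' : IsFace P D F G) (hE : E.radius = s) (hF : F.radius = s)
    (hG : G.radius = 1) : HasSeparatedCorona P s D := by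
  have hB := hP.isBoundedPacking hs hsr hr
  obtain ⟨T, rfl, rfl, rfl, hT⟩ := exists_turn_of_faces hB hP.compact h h'
  have t1s := tangentAngle_one_small hs h₂
  have hpi := Real.pi_pos
  have tss := tangentAngle_self hs
  have hsum := hT.eq_five hs hB h₂ hD (Or.inr hG) (by
    rw [turnAngle_two hD, hE, hF, hG, tangentAngle_comm s s 1, t1s, tss]; linarith)
  obtain ⟨hsum, h5⟩ := hsum
  rw [turnAngle_five hD, h5, hE, hF, hG, tangentAngle_comm s s 1, t1s, tss] at hsum
  obtain ⟨e3, e4⟩ := eq_small_large_of_angle_sum_one_small hs hsr h₁ h₂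
    (hP.radii _ (hT 3).mem₂) (hP.radii _ (hT 4).mem₂) (by linarith)
  exact ⟨hD, T 2, T 3, T 4, T 0, T 1, ⟨hG, e3, e4, hE, hF⟩, hT 2, hT 3, h5 ▸ hT 4, hT 0, hT 1⟩

include hs hsr hr h₁ h₂ hP in
lemma hasSeparatedCorona_of_large_small_small {D E F G : Disc} (hD : D.radius = s)
    (h : IsFace P D E F) (h' : IsFace P D F G) (hE : E.radius = 1) (hF : F.radius = s)
    (hG : G.radius = s) : HasSeparatedCorona P s D := by
  have hB := hP.isBoundedPacking hs hsr hr
  obtain ⟨T, rfl, rfl, rfl, hT⟩ := exists_turn_of_faces hB hP.compact h h'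
  have t1s := tangentAngle_one_small hs h₂
  have hpi := Real.pi_pos
  have tss := tangentAngle_self hs
  have hsum := hT.eq_five hs hB h₂ hD (Or.inl hE) (by
    rw [turnAngle_two hD, hE, hF, hG, t1s, tss]; linarith)
  obtain ⟨hsum, h5⟩ := hsum
  rw [turnAngle_five hD, h5, hE, hF, hG, t1s, tss, tangentAngle_comm s s (T 3).radius,
    tangentAngle_comm (T 3).radius s (T 4).radius, tangentAngle_comm (T 4).radius s 1] at hsum
  -- The gap is read clockwise, from the large disc `T 0` back to the small disc `T 2`.
  obtain ⟨e4, e3⟩ := eq_small_large_of_angle_sum_one_small hs hsr h₁ h₂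
    (hP.radii _ (hT 4).mem₂) (hP.radii _ (hT 3).mem₂) (by linarith)
  exact ⟨hD, T 3, T 4, T 0, T 1, T 2, ⟨e3, e4, hE, hF, hG⟩, hT 3, h5 ▸ hT 4, hT 0, hT 1, hT 2⟩

include hs hsr hr h₁ h₂ hP in
/-- The small discs touching a disc with corona `1s1ss` have this corona as well. -/
lemma HasSeparatedCorona.of_tangent {S G : Disc} (h : HasSeparatedCorona P s S) (hG : G ∈ P)
    (hSG : S.Tangent G) : G.radius = 1 ∨ HasSeparatedCorona P s G := by
  obtain ⟨hS, A, a, B, b, c, ⟨rA, ra, rB, rb, rc⟩, f0, f1, f2, f3, f4⟩ := h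
  rcases eq_of_five_faces (hP.isBoundedPacking hs hsr hr) hP.compact f0 f1 f2 f3 f4 hG hSG with
    rfl | rfl | rfl | rfl | rfl
  · exact Or.inl rA
  · exact Or.inr (hasSeparatedCorona_of_large_small_large hs hsr hr h₂ hP ra f1.rotate
      f0.rotate.rotate rB hS rA)
  · exact Or.inl rB
  · exact Or.inr (hasSeparatedCorona_of_small_small_large hs hsr hr h₁ h₂ hP rb f3.rotate
      f2.rotate.rotate rc hS rB)
  · exact Or.inr (hasSeparatedCorona_of_large_small_small hs hsr hr h₁ h₂ hP rc f4.rotate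
      f3.rotate.rotate rA hS rb)

include hs hsr hr h₁ h₂ hP in
/-- The discs touching a large disc that touches a disc with corona `1s1ss` have this corona. -/
lemma HasSeparatedCorona.of_tangent_large {S L G : Disc} (h : HasSeparatedCorona P s S)
    (hL : L ∈ P) (hSL : S.Tangent L) (rL : L.radius = 1) (hG : G ∈ P) (hLG : L.Tangent G) :
    HasSeparatedCorona P s G := by
  have hB := hP.isBoundedPacking hs hsr hr
  have step : ∀ S E, HasSeparatedCorona P s S → IsFace P L S E → HasSeparatedCorona P s E := by
    intro S E hS hE
    have hS' := hS
    obtain ⟨rS, A, a, B, b, c, ⟨rA, ra, rB, rb, rc⟩, f0, f1, f2, f3, f4⟩ := hS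
    have hne : s ≠ 1 := (hsr.trans hr).ne
    have hE' : E.radius = s := by
      -- L is A or B, and E is the disc preceding it around S: c or a, both small.
      rcases eq_of_five_faces hB hP.compact f0 f1 f2 f3 f4 hL hE.tangent₁₂.symm with
        rfl | rfl | rfl | rfl | rfl
      · rw [hE.rotate.unique' hB.packing f4, rc]
      · exact absurd (ra.symm.trans rL) hne
      · rw [hE.rotate.unique' hB.packing f1, ra]
      · exact absurd (rb.symm.trans rL) hne
      · exact absurd (rc.symm.trans rL) hne
    rcases hS'.of_tangent hs hsr hr h₁ h₂ hP hE.mem₃ hE.tangent₂₃ with h1 | h1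
    · exact absurd (hE'.symm.trans h1) hne
    · exact h1
  obtain ⟨E, hE0, hE⟩ := hB.exists_turn hP.compact hL h.mem hSL.symm
  obtain ⟨n, -, -, -, hcov⟩ := hE.exists_full_turn hB
  have key : ∀ i, HasSeparatedCorona P s (E i) := by
    intro i
    induction i with
    | zero => rwa [hE0]
    | succ i ih => exact step _ _ ih (hE i)
  obtain ⟨i, -, rfl⟩ := hcov G hG hLG
  exact key i

include hs hsr hr h₁ h₂ hP in
lemma not_hasSeparatedCorona (S : Disc) : ¬ HasSeparatedCorona P s S := by
  intro hS
  obtain ⟨M, hM, rM⟩ := hP.exists_medium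
  have hMC := (hP.isBoundedPacking hs hsr hr).mem_of_tangent_closed hP.compact
    (C := {D ∈ P | HasSeparatedCorona P s D ∨
      (D.radius = 1 ∧ ∃ S, HasSeparatedCorona P s S ∧ S.Tangent D)})
    (fun D hD => hD.1) ⟨S, hS.mem, Or.inl hS⟩ (by
      rintro D ⟨hD, hDS | ⟨rD, S, hS, hSD⟩⟩ E hE hDE
      · refine ⟨hE, ?_⟩
        rcases hDS.of_tangent hs hsr hr h₁ h₂ hP hE hDE with h | h
        · exact Or.inr ⟨h, D, hDS, hDE⟩
        · exact Or.inl h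
      · exact ⟨hE, Or.inl (hS.of_tangent_large hs hsr hr h₁ h₂ hP hD hSD rD hE hDE)⟩) hM
  rcases hMC.2 with h | ⟨h, -⟩
  · exact hsr.ne (h.1.symm.trans rM)
  · exact hr.ne (rM.symm.trans h)

include hs hsr hr h₂ hP in
-- The coding supplies the radii with multiplicity; the angle sum along the actual turn recovers
-- their cyclic order.
lemma hasSeparatedCorona_of_isCoronaCoding {S : Disc} (hS : S ∈ P) (rS : S.radius = s)
    (h : IsCoronaCoding P S [1, s, 1, s, s]) : HasSeparatedCorona P s S := by
  have hB := hP.isBoundedPacking hs hsr hr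
  obtain ⟨L, hnd, hmem, -, hrad⟩ := h
  obtain ⟨L₀, hL₀, rL₀⟩ : ∃ E ∈ L, E.radius = 1 := by
    rw [← List.mem_map, hrad]; simp
  have hcor := (hmem L₀).1 hL₀
  obtain ⟨E, rfl, hE⟩ := hB.exists_turn hP.compact hS hcor.1 hcor.2.symm
  obtain ⟨n, hn, hn0, hinj, hcov⟩ := hE.exists_full_turn hB
  have hperm : ((List.range n).map E).Perm L := by
    refine (List.perm_ext_iff_of_nodup ?_ hnd).2 fun G => ?_
    · exact List.Nodup.map_on (fun i hi j hj he =>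
        hinj (List.mem_range.1 hi) (List.mem_range.1 hj) he) List.nodup_range
    · rw [hmem, List.mem_map]
      constructor
      · rintro ⟨i, -, rfl⟩
        exact ⟨(hE i).mem₂, (hE i).tangent₁₂.symm⟩
      · rintro ⟨hG, hGS⟩
        obtain ⟨i, hi, rfl⟩ := hcov G hG hGS.symm
        exact ⟨i, List.mem_range.2 hi, rfl⟩
  have hperm' := hperm.map Disc.radius
  rw [hrad, List.map_map] at hperm'
  obtain rfl : n = 5 := by simpa using hperm'.length_eq
  have hvals : ∀ i < 5, (E i).radius = 1 ∨ (E i).radius = s := by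
    intro i hi
    have : (E i).radius ∈ [1, s, 1, s, s] :=
      hperm'.subset (List.mem_map.2 ⟨i, List.mem_range.2 hi, rfl⟩)
    simp at this
    tauto
  have hsum := hperm'.sum_eq
  simp [List.range_succ] at hsum
  have hs1 : s < 1 := hsr.trans hr
  have hpi := Real.pi_pos
  rw [turnAngle_five rS, hn0, rL₀] at hn
  have t11 := (tangentAngle_one_one_bounds hs h₂).1
  have t1s := tangentAngle_one_small hs h₂
  have tss := tangentAngle_self hs
  have ts1 := tangentAngle_comm s s 1
  have g4 := hE 4
  rw [hn0] at g4
  -- The sum of the radii leaves exactly two large discs. If they were adjacent, the angles would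
  -- exceed π/2 + 2 · 5π/12 + 2 · π/3 = 2π, so the second one is `E 2` or `E 3`.
  rcases hvals 1 (by norm_num) with e1 | e1 <;> rcases hvals 2 (by norm_num) with e2 | e2 <;>
    rcases hvals 3 (by norm_num) with e3 | e3 <;> rcases hvals 4 (by norm_num) with e4 | e4 <;>
    rw [rL₀, e1, e2, e3, e4] at hsum <;> rw [e1, e2, e3, e4] at hn <;>
    first
    | (exfalso; linarith)
    | exact ⟨rS, E 0, E 1, E 2, E 3, E 4, ⟨rL₀, e1, e2, e3, e4⟩, hE 0, hE 1, hE 2, hE 3, g4⟩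
    | exact ⟨rS, E 3, E 4, E 0, E 1, E 2, ⟨e3, e4, rL₀, e1, e2⟩, hE 3, g4, hE 0, hE 1, hE 2⟩

end

theorem mainTheorem2 (r s : ℝ) (hs : 0 < s) (hsr : s < r) (hr : r < 1)
    (h₁ : CoronaCompatible s [1, s, r, r, s]) (h₂ : CoronaCompatible s [1, s, 1, s, s])
    (P : Set Disc) (hP : IsThreeSizePacking r s P) :
    ¬ ContainsCorona P s [1, s, 1, s, s] := by
  rintro ⟨S, hS, rS, hcod⟩
  exact not_hasSeparatedCorona hs hsr hr h₁ h₂ hP S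
    (hasSeparatedCorona_of_isCoronaCoding hs hsr hr h₂ hP hS rS hcod)
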